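/- Let $\mathbb D$ be the open unit disk and $\partial\mathbb D$ the unit circle with arc length $|d\xi|$; for an arc $I\subseteq\partial\mathbb D$ (nondegenerate, possibly all of $\partial\mathbb D$) let $|I|=\frac1{2\pi}\int_I|d\xi|$ and let $S(I)=\{z\in\mathbb D:\ 1-|I|\le|z|<1,\ z/|z|\in I\}$ be its Carleson square, with $S(\partial\mathbb D)=\mathbb D$. Let $\mu$ be a positive Borel measure on $\mathbb D$, and let $\omega:\partial\mathbb D\to[0,\infty)$ be a measurable function satisfying the $A_1$ condition: there is a constant $C>0$ with $$\frac1{|I|}\int_I\omega(\xi)\,|d\xi|\ \le\ C\,\operatorname*{ess\,inf}_{\xi\in I}\omega(\xi)\qquad\text{for all arcs } I\subseteq\partial\mathbb D .$$ For $0<p<\infty$ let $H^p(\omega)$ be the set of all $f$ in the classical Hardy space $H^1$ of $\mathbb D$ whose boundary function (the non-tangential limit $f(\xi)$, which exists for almost every $\xi\in\partial\mathbb D$) satisfies $$\|f\|_{H^p(\omega)}:=\Big(\frac1{2\pi}\int_{\partial\mathbb D}|f(\xi)|^p\,\omega(\xi)\,|d\xi|\Big)^{1/p}<\infty .$$ Let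 $0<p\le q<\infty$. Then there is a constant $C>0$ such that $$\Big(\int_{\mathbb D}|f|^q\,d\mu\Big)^{1/q}\ \le\ C\,\|f\|_{H^p(\omega)}\qquad\text{for all } f\in H^p(\omega)$$ if and only if there is a constant $C>0$ such that $$\mu(S(I))\ \le\ C\Big(\int_I\omega(\xi)\,|d\xi|\Big)^{q/p}\qquad\text{for all arcs } I\subseteq\partial\mathbb D .$$ -/

import Mathlib

open MeasureTheory Filter Topology Set Metric
open scoped NNReal ENNReal Real

noncomputable section

namespace WeightedHardy

/-- The open unit disk, as a type (with its Borel σ-algebra). -/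
abbrev Disk : Type := ball (0 : ℂ) 1

/-- The Borel σ-algebra of the unit circle. -/
instance : MeasurableSpace Circle := borel Circle

instance : BorelSpace Circle := ⟨rfl⟩

/-- Arc length measure `|dξ|` on the unit circle, of total mass `2π`. -/
def arcLength : Measure Circle :=
  (volume.restrict (Ioc (-π) π)).map Circle.exp

/-- Normalized Lebesgue measure `(1 / 2π) |dξ|` on the unit circle. -/
def normArcLength : Measure Circle := (ENNReal.ofReal (2 * π))⁻¹ • arcLength

/-- (Nondegenerate) arcs of the unit circle: images of nondegenerate intervals of any kind under
`t ↦ exp (i t)`. The full circle is an arc. -/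
def IsArc (I : Set Circle) : Prop :=
  ∃ J : Set ℝ, J.OrdConnected ∧ J.Nontrivial ∧ I = Circle.exp '' J

/-- The integral `∫_I ω(ξ) |dξ|`. -/
def weightMass (ω : Circle → ℝ≥0) (I : Set Circle) : ℝ≥0∞ := ∫⁻ ξ in I, ω ξ ∂arcLength

/-- The Muckenhoupt condition `A₁`: the mean of `ω` over an arc is bounded by a constant
multiple of the (essential) infimum of `ω` over that arc. -/
def IsA1 (ω : Circle → ℝ≥0) : Prop :=
  ∃ C : ℝ≥0, 0 < C ∧ ∀ I : Set Circle, IsArc I →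
    (⨍⁻ ξ in I, (ω ξ : ℝ≥0∞) ∂arcLength) ≤
      C * essInf (fun ξ => (ω ξ : ℝ≥0∞)) (arcLength.restrict I)

/-- The Carleson square `S(I)`: the points `z` of the disk with `1 - |I| ≤ |z|` lying on a radius
that ends in `I`, where `|I|` is the normalized length. The centre of the disk lies on every
radius, so `S(I)` is the whole disk when `I` is the whole circle. -/
def carlesonBox (I : Set Circle) : Set Disk :=
  {z | 1 - (normArcLength I).toReal ≤ ‖(z : ℂ)‖ ∧ ∃ ξ ∈ I, (z : ℂ) = ‖(z : ℂ)‖ * (ξ : ℂ)}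

/-- The Hardy space `H¹` of the disk. -/
def MemH1 (f : ℂ → ℂ) : Prop :=
  DifferentiableOn ℂ f (ball 0 1) ∧
    (⨆ r ∈ Ioo (0 : ℝ) 1, ∫⁻ ξ : Circle, ‖f (r * ξ)‖ₑ ∂normArcLength) < ∞

/-- The non-tangential approach region at `ξ`. -/
def approachRegion (ξ : Circle) : Set ℂ := {z | ‖z‖ < 1 ∧ ‖(ξ : ℂ) - z‖ < 2 * (1 - ‖z‖)}

/-- The boundary function of `f`: its non-tangential limit at `ξ` (an arbitrary value at the
points `ξ` where there is no limit, which for `f ∈ H¹` form a null set). -/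
def boundaryValue (f : ℂ → ℂ) (ξ : Circle) : ℂ :=
  limUnder (𝓝[approachRegion ξ] (ξ : ℂ)) f

/-- The measure `(1 / 2π) ω(ξ) |dξ|`, so that `L^p(ω)` is the `L^p` space of this measure. -/
def weightedMeasure (ω : Circle → ℝ≥0) : Measure Circle :=
  normArcLength.withDensity (fun ξ => (ω ξ : ℝ≥0∞))

/-- Membership in the weighted Hardy space `H^p(ω)`: functions in `H¹` whose boundary function
lies in `L^p(ω)`. -/
def MemWeightedHardy (p : ℝ) (ω : Circle → ℝ≥0) (f : ℂ → ℂ) : Prop :=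
  MemH1 f ∧ MemLp (boundaryValue f) (ENNReal.ofReal p) (weightedMeasure ω)

/-- The norm `‖f‖_{H^p(ω)}`, that is, the `L^p(ω)` norm of the boundary function. -/
def weightedHardyNorm (p : ℝ) (ω : Circle → ℝ≥0) (f : ℂ → ℂ) : ℝ≥0∞ :=
  eLpNorm (boundaryValue f) (ENNReal.ofReal p) (weightedMeasure ω)

end WeightedHardy

end

/-!
The sufficiency of the Carleson condition rests on a covering argument in which the `A₁` condition
takes the place of the boundedness of a weighted maximal operator. Let `f ∈ H^p(ω)`, `t = q / p` and
`g = |f|^(p/2)` on the circle. Since `|f|^(p/2)` is dominated by the Poisson integral of `g`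
(`MemH1.enorm_rpow_le`), the value `|f(z)|^(p/2)` is at most a constant times the supremum of the
averages of `g` over the arcs about `z / |z|` of radius at least `1 - |z|`
(`lintegral_poisson_mul_le`). By Vitali's covering lemma, the set where one of these averages
exceeds `l` is covered by Carleson squares over enlargements of disjoint arcs `I` with
`l |I| < ∫_I g`. The Carleson condition and the `A₁` condition bound the `μ`-measure of such a square
by `(A |I| ω(ζ))^t` for almost every `ζ ∈ I`, hence by `((A / l) ∫_I g ω)^t`; as `t ≥ 1`, these
bounds can be summed (`measure_exists_lt_setLIntegral_le`). Cutting `g` off at height `l` and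
integrating over the levels gives `∫ |f|^q dμ ≤ C (∫ g² ω)^t`
(`lintegral_rpow_le_of_forall_setLIntegral_le`). Working with the power `p/2` rather than `p` leaves
room for this step, since averages satisfy only a weak type estimate on `L¹`.

Arcs are handled as closed balls of the chord metric of the circle, for which Vitali's lemma and
Lebesgue's differentiation theorem are available.

The facts on `H¹` that are needed come from the same estimates. For a polynomial `P`, reflecting the
zeros that lie in the disk produces an analytic branch `G` with `|P|^s ≤ |G|` and equality on the
circle; so `|P|^s`, and by approximation `|h|^s` for `h` analytic near the closed disk, is dominated
by its Poisson integral (`enorm_rpow_le_lintegral_poisson`). For `f ∈ H¹` the dilates of `|f|^(1/2)`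
are bounded in `L²`, so a weak limit `φ ∈ L²` gives `|f|^(1/2) ≤ P[φ]`, and the maximal estimate with
`ω = 1` shows that the radial maximal function `F` of `f` is integrable
(`MemH1.lintegral_iSup_lt_top`). A weak limit of the dilates in `L²((1 + F)|dξ|)`, after division by
`1 + F`, represents `f` as the Poisson integral of an integrable function
(`MemH1.exists_eq_integral_poisson`); Fatou's theorem (`ae_tendsto_integral_poisson`) provides the
boundary values, and dominated convergence the bound by `P[|f|^s]`.

For the necessity the embedding is tested on `z ↦ (1 - ā z)^(-N)` with `a = (1 - |I|) ξ₀`, `ξ₀ ∈ I`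
and `N p ≥ 2`. On the circle its `p`-th power is at most `|I|^(1 - N p)` times the Poisson kernel at
`a`, so that the norm is controlled by the averages of `ω` over arcs containing `I`, which the `A₁`
condition compares with the average over `I`.
-/

namespace WeightedHardy

/-! ### Arc length on the circle -/

/-- Arc length is the image of Lebesgue measure on any half-open interval of length `2π`. -/
theorem arcLength_eq_map (a : ℝ) :
    arcLength = (volume.restrict (Ioc a (a + 2 * π))).map Circle.exp := by
  have : Fact (0 < 2 * π) := ⟨Real.two_pi_pos⟩
  have key : ∀ b : ℝ, (volume.restrict (Ioc b (b + 2 * π))).map Circle.exp =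
      (volume : Measure (AddCircle (2 * π))).map AddCircle.toCircle := by
    intro b
    rw [← (AddCircle.measurePreserving_mk (2 * π) b).map_eq, Measure.map_map]
    · congr 1
      ext x
      simp [AddCircle.toCircle_apply_mk, Real.pi_ne_zero]
    · exact AddCircle.continuous_toCircle.measurable
    · exact (AddCircle.measurePreserving_mk (2 * π) b).measurable
  rw [key a, ← key (-π), arcLength]
  congr 3
  ring

theorem arcLength_univ : arcLength univ = ENNReal.ofReal (2 * π) := by
  rw [arcLength, Measure.map_apply Circle.exp.continuous.measurable MeasurableSet.univ]
  rw [preimage_univ, Measure.restrict_apply_univ, Real.volume_Ioc]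
  ring_nf

instance : IsFiniteMeasure arcLength := ⟨by rw [arcLength_univ]; exact ENNReal.ofReal_lt_top⟩

theorem ofReal_two_pi_ne_zero : ENNReal.ofReal (2 * π) ≠ 0 := by
  simp [Real.pi_pos]

theorem normArcLength_apply (s : Set Circle) :
    normArcLength s = (ENNReal.ofReal (2 * π))⁻¹ * arcLength s := rfl

theorem arcLength_eq_smul : arcLength = ENNReal.ofReal (2 * π) • normArcLength := by
  rw [normArcLength, smul_smul, ENNReal.mul_inv_cancel ofReal_two_pi_ne_zero ENNReal.ofReal_ne_top,
    one_smul]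

theorem arcLength_apply (s : Set Circle) :
    arcLength s = ENNReal.ofReal (2 * π) * normArcLength s := by
  rw [arcLength_eq_smul]; rfl

instance : IsProbabilityMeasure normArcLength := ⟨by
  rw [normArcLength_apply, arcLength_univ,
    ENNReal.inv_mul_cancel ofReal_two_pi_ne_zero ENNReal.ofReal_ne_top]⟩

theorem le_arcLength_image_exp {a b : ℝ} (hb : b ≤ a + 2 * π) {S : Set Circle}
    (hS : Circle.exp '' Icc a b ⊆ S) : ENNReal.ofReal (b - a) ≤ arcLength S := by
  refine le_trans ?_ (measure_mono hS)
  rw [arcLength_eq_map a, Measure.map_apply Circle.exp.continuous.measurable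
    (isCompact_Icc.image Circle.exp.continuous).isClosed.measurableSet,
    Measure.restrict_apply' measurableSet_Ioc, ← Real.volume_Ioc]
  apply measure_mono
  intro x hx
  exact ⟨mem_image_of_mem _ ⟨hx.1.le, hx.2⟩, hx.1, hx.2.trans hb⟩

theorem arcLength_image_exp_le (a b : ℝ) :
    arcLength (Circle.exp '' Icc a b) ≤ ENNReal.ofReal (b - a) := by
  rcases le_total (a + 2 * π) b with h | h
  · calc _ ≤ arcLength univ := measure_mono (subset_univ _)
      _ = ENNReal.ofReal (2 * π) := arcLength_univ
      _ ≤ _ := ENNReal.ofReal_le_ofReal (by linarith)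
  rw [arcLength_eq_map a, Measure.map_apply Circle.exp.continuous.measurable
    (isCompact_Icc.image Circle.exp.continuous).isClosed.measurableSet,
    Measure.restrict_apply' measurableSet_Ioc, ← Real.volume_Icc]
  have hsub : Circle.exp ⁻¹' (Circle.exp '' Icc a b) ∩ Ioc a (a + 2 * π) ⊆
      Icc a b ∪ {a + 2 * π} := by
    rintro x ⟨⟨y, hy, hyx⟩, hx⟩
    rcases hy.1.eq_or_lt with rfl | hlt
    · right
      have : Circle.exp (a + 2 * π) = Circle.exp x := by rw [Circle.exp_add_two_pi, hyx]
      exact (Circle.exp_injOn_Ioc (by simp) ⟨by simp [Real.pi_pos], le_rfl⟩ hx this).symm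
    · left
      have : y = x := Circle.exp_injOn_Ioc (a := a) (b := a + 2 * π) (by simp)
        ⟨hlt, hy.2.trans h⟩ hx hyx
      exact this ▸ hy
  calc _ ≤ volume (Icc a b ∪ {a + 2 * π}) := measure_mono hsub
    _ ≤ volume (Icc a b) + volume {a + 2 * π} := measure_union_le _ _
    _ = _ := by simp

theorem circle_dist_eq (x y : Circle) : dist x y = ‖(x : ℂ) - y‖ := by
  exact dist_eq_norm (x : ℂ) y

theorem dist_exp (a b : ℝ) : dist (Circle.exp a) (Circle.exp b) = 2 * |Real.sin ((a - b) / 2)| := by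
  have h : (Circle.exp a : ℂ) - Circle.exp b =
      Circle.exp b * (Complex.exp (Complex.I * (a - b : ℝ)) - 1) := by
    rw [Circle.coe_exp, Circle.coe_exp, mul_sub, ← Complex.exp_add]
    push_cast; ring_nf
  rw [circle_dist_eq, h, norm_mul, Circle.norm_coe, one_mul,
    Complex.norm_exp_I_mul_ofReal_sub_one]
  simp

theorem dist_exp_le (a b : ℝ) : dist (Circle.exp a) (Circle.exp b) ≤ |a - b| := by
  rw [dist_exp]
  have := Real.abs_sin_le_abs (x := (a - b) / 2)
  rw [abs_div, abs_two] at this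
  linarith

theorem dist_circle_le_two (x y : Circle) : dist x y ≤ 2 := by
  rw [circle_dist_eq]
  calc _ ≤ ‖(x : ℂ)‖ + ‖(y : ℂ)‖ := norm_sub_le _ _
    _ = 2 := by rw [Circle.norm_coe, Circle.norm_coe]; norm_num

theorem closedBall_eq_univ {ξ : Circle} {ρ : ℝ} (h : 2 ≤ ρ) : closedBall ξ ρ = univ :=
  eq_univ_of_forall fun x => (dist_circle_le_two x ξ).trans h

theorem exists_exp_eq_abs_sub_le (ξ : Circle) (t : ℝ) : ∃ x : ℝ, Circle.exp x = ξ ∧ |x - t| ≤ π := by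
  obtain ⟨y, hy⟩ := Circle.exp_surjective (ξ * (Circle.exp t)⁻¹)
  refine ⟨t + (Circle.exp y : ℂ).arg, ?_, ?_⟩
  · rw [Circle.exp_add, Circle.exp_arg, hy, mul_inv_cancel_comm_assoc]
  · simpa using Complex.abs_arg_le_pi _

theorem abs_sin_half_le {u v : ℝ} (huv : |u| ≤ |v|) (hv : |v| ≤ π) :
    |Real.sin (u / 2)| ≤ |Real.sin (v / 2)| := by
  have key : ∀ w : ℝ, |w| ≤ π → |Real.sin (w / 2)| = Real.sin (|w| / 2) := by
    intro w hw
    rcases abs_cases w with ⟨h, h'⟩ | ⟨h, h'⟩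
    · rw [h] at hw ⊢
      exact abs_of_nonneg (Real.sin_nonneg_of_nonneg_of_le_pi (by linarith) (by linarith))
    · rw [h] at hw ⊢
      rw [neg_div, Real.sin_neg, abs_of_nonpos]
      exact Real.sin_nonpos_of_nonpos_of_neg_pi_le (by linarith) (by linarith)
  rw [key u (huv.trans hv), key v hv]
  apply Real.sin_le_sin_of_le_of_le_pi_div_two <;> linarith [abs_nonneg u, Real.pi_pos]

/-- Closed balls for the chord metric are arcs. -/
theorem isArc_closedBall (ξ : Circle) {ρ : ℝ} (hρ : 0 < ρ) : IsArc (closedBall ξ ρ) := by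
  obtain ⟨t, rfl⟩ := Circle.exp_surjective ξ
  refine ⟨{x | |x - t| ≤ π ∧ dist (Circle.exp x) (Circle.exp t) ≤ ρ}, ⟨?_⟩, ?_, ?_⟩
  · rintro x ⟨hx1, hx2⟩ y ⟨hy1, hy2⟩ z ⟨hz1, hz2⟩
    have : |z - t| ≤ |x - t| ∨ |z - t| ≤ |y - t| := by
      rcases le_total z t with h | h
      · left; rw [abs_of_nonpos (by linarith), abs_of_nonpos (by linarith)]; linarith
      · right; rw [abs_of_nonneg (by linarith), abs_of_nonneg (by linarith)]; linarith
    rcases this with h | h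
    · refine ⟨h.trans hx1, le_trans ?_ hx2⟩
      rw [dist_exp, dist_exp]; linarith [abs_sin_half_le h hx1]
    · refine ⟨h.trans hy1, le_trans ?_ hy2⟩
      rw [dist_exp, dist_exp]; linarith [abs_sin_half_le h hy1]
  · have hm : 0 < min ρ π := lt_min hρ Real.pi_pos
    have e : |t + min ρ π - t| = min ρ π := by rw [add_sub_cancel_left, abs_of_pos hm]
    refine ⟨t, by simp [Real.pi_pos.le, hρ.le], t + min ρ π, ⟨?_, ?_⟩, by linarith⟩
    · rw [e]; exact min_le_right _ _
    · refine (dist_exp_le _ _).trans ?_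
      rw [e]; exact min_le_left _ _
  · ext η
    constructor
    · intro h
      obtain ⟨x, rfl, hx⟩ := exists_exp_eq_abs_sub_le η t
      exact ⟨x, ⟨hx, h⟩, rfl⟩
    · rintro ⟨x, hx, rfl⟩
      exact hx.2

theorem normArcLength_le_of_arcLength_le {s : Set Circle} {r : ℝ}
    (h : arcLength s ≤ ENNReal.ofReal (2 * π * r)) : normArcLength s ≤ ENNReal.ofReal r := by
  rw [normArcLength_apply]
  calc _ ≤ (ENNReal.ofReal (2 * π))⁻¹ * ENNReal.ofReal (2 * π * r) := by gcongr
    _ = _ := by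
      rw [ENNReal.ofReal_mul Real.two_pi_pos.le, ← mul_assoc,
        ENNReal.inv_mul_cancel ofReal_two_pi_ne_zero ENNReal.ofReal_ne_top, one_mul]

theorem normArcLength_closedBall_le (ξ : Circle) (ρ : ℝ) :
    normArcLength (closedBall ξ ρ) ≤ ENNReal.ofReal ρ := by
  apply normArcLength_le_of_arcLength_le
  obtain ⟨t, rfl⟩ := Circle.exp_surjective ξ
  have hsub : closedBall (Circle.exp t) ρ ⊆
      Circle.exp '' Icc (t - π / 2 * ρ) (t + π / 2 * ρ) := by
    intro η hη
    obtain ⟨x, rfl, hx⟩ := exists_exp_eq_abs_sub_le η t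
    refine ⟨x, ?_, rfl⟩
    rw [mem_closedBall, dist_exp] at hη
    have h1 := Real.mul_abs_le_abs_sin (x := (x - t) / 2) (by
      rw [abs_div, abs_two]; linarith)
    rw [abs_div, abs_two] at h1
    have h2 : 2 / π * |x - t| ≤ ρ := by linarith
    have h3 : |x - t| ≤ π / 2 * ρ := by
      calc |x - t| = π / 2 * (2 / π * |x - t|) := by field_simp
        _ ≤ _ := by gcongr
    rw [abs_le] at h3
    constructor <;> linarith
  refine (measure_mono hsub).trans ((arcLength_image_exp_le _ _).trans ?_)
  rcases le_total 0 ρ with h | h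
  · exact ENNReal.ofReal_le_ofReal (by nlinarith [Real.pi_pos])
  · rw [ENNReal.ofReal_of_nonpos (by nlinarith [Real.pi_pos])]; exact zero_le

theorem le_normArcLength_closedBall (ξ : Circle) {ρ : ℝ} :
    ENNReal.ofReal (min (ρ / (2 * π)) 1) ≤ normArcLength (closedBall ξ ρ) := by
  obtain ⟨t, rfl⟩ := Circle.exp_surjective ξ
  have hsub : Circle.exp '' Icc t (t + min ρ (2 * π)) ⊆ closedBall (Circle.exp t) ρ := by
    rintro _ ⟨x, hx, rfl⟩
    refine (dist_exp_le _ _).trans ?_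
    rw [abs_of_nonneg (by linarith [hx.1])]
    linarith [hx.2, min_le_left ρ (2 * π)]
  have := le_arcLength_image_exp (by linarith [min_le_right ρ (2 * π)]) hsub
  rw [add_sub_cancel_left] at this
  have e : min (ρ / (2 * π)) 1 = (2 * π)⁻¹ * min ρ (2 * π) := by
    rw [mul_min_of_nonneg _ _ (by positivity), inv_mul_cancel₀ Real.two_pi_pos.ne', div_eq_inv_mul]
  rw [e, ENNReal.ofReal_mul (by positivity), normArcLength_apply,
    ENNReal.ofReal_inv_of_pos Real.two_pi_pos]
  gcongr

/-- The distance of two points of an arc is at most the length of the arc. -/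
theorem ofReal_dist_le_arcLength {I : Set Circle} (hI : IsArc I) {ξ η : Circle} (hξ : ξ ∈ I)
    (hη : η ∈ I) : ENNReal.ofReal (dist ξ η) ≤ arcLength I := by
  obtain ⟨J, hJ, -, rfl⟩ := hI
  obtain ⟨a, ha, rfl⟩ := hξ
  obtain ⟨b, hb, rfl⟩ := hη
  wlog h : a ≤ b generalizing a b
  · rw [dist_comm]; exact this b hb a ha (le_of_not_ge h)
  rcases le_total b (a + 2 * π) with h' | h'
  · refine le_trans (ENNReal.ofReal_le_ofReal ?_)
      (le_arcLength_image_exp h' (image_mono (hJ.out ha hb)))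
    rw [dist_comm]
    exact (dist_exp_le _ _).trans_eq (abs_of_nonneg (by linarith))
  · refine le_trans (ENNReal.ofReal_le_ofReal ?_)
      (le_arcLength_image_exp (a := a) (b := a + 2 * π) le_rfl
        (image_mono ((Icc_subset_Icc_right h').trans (hJ.out ha hb))))
    linarith [dist_circle_le_two (Circle.exp a) (Circle.exp b), Real.pi_gt_three]

theorem IsArc.nonempty {I : Set Circle} (hI : IsArc I) : I.Nonempty := by
  obtain ⟨J, -, hJ, rfl⟩ := hI
  exact hJ.nonempty.image _

theorem IsArc.arcLength_pos {I : Set Circle} (hI : IsArc I) : 0 < arcLength I := by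
  obtain ⟨J, hJ, ⟨a, ha, b, hb, hab⟩, rfl⟩ := hI
  wlog h : a < b generalizing a b
  · exact this b hb a ha hab.symm (lt_of_le_of_ne (le_of_not_gt h) hab.symm)
  refine lt_of_lt_of_le ?_ (le_arcLength_image_exp (a := a) (b := min b (a + 2 * π))
    (min_le_right _ _) (image_mono ((Icc_subset_Icc_right (min_le_left _ _)).trans (hJ.out ha hb))))
  simp [h, Real.pi_pos]

theorem integral_normArcLength {E : Type*} [NormedAddCommGroup E] [NormedSpace ℝ E]
    {F : ℂ → E} (hF : Continuous fun ξ : Circle => F ξ) :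
    ∫ ξ : Circle, F ξ ∂normArcLength = Real.circleAverage F 0 1 := by
  rw [normArcLength, integral_smul_measure, arcLength_eq_map 0,
    integral_map Circle.exp.continuous.measurable.aemeasurable hF.aestronglyMeasurable,
    Real.circleAverage_def, intervalIntegral.integral_of_le Real.two_pi_pos.le, zero_add,
    ENNReal.toReal_inv, ENNReal.toReal_ofReal Real.two_pi_pos.le]
  simp [circleMap, Circle.coe_exp]

instance : IsUnifLocDoublingMeasure normArcLength := by
  refine ⟨⟨Real.toNNReal (4 * π), ?_⟩⟩
  filter_upwards [Ioc_mem_nhdsGT (zero_lt_one' ℝ)] with ε hε x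
  refine (normArcLength_closedBall_le _ _).trans ?_
  refine le_trans ?_ (mul_le_mul_right (le_normArcLength_closedBall x) _)
  have : ((4 * π).toNNReal : ℝ≥0∞) = ENNReal.ofReal (4 * π) := rfl
  rw [this, ← ENNReal.ofReal_mul (by positivity), min_eq_left]
  · apply ENNReal.ofReal_le_ofReal
    field_simp; linarith
  · rw [div_le_one Real.two_pi_pos]; linarith [hε.2, Real.pi_gt_three]

/-! ### Weak and strong type estimates for averages over arcs -/

/-- The form of the `A₁` condition used throughout: on every chord ball `B` of radius `ρ`, the
integral of `ω` over `B` is at most `A ρ ω(ζ)` for almost every `ζ ∈ B`. -/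
theorem IsA1.exists_setLIntegral_closedBall_le {ω : Circle → ℝ≥0} (h : IsA1 ω) :
    ∃ A : ℝ≥0, ∀ (ξ : Circle) (ρ : ℝ), 0 < ρ →
      ∀ᵐ ζ ∂normArcLength.restrict (closedBall ξ ρ),
        ∫⁻ x in closedBall ξ ρ, ω x ∂normArcLength ≤ A * ENNReal.ofReal ρ * ω ζ := by
  obtain ⟨A, -, hA⟩ := h
  refine ⟨A, fun ξ ρ hρ => ?_⟩
  have h1 : ∀ᵐ ζ ∂normArcLength.restrict (closedBall ξ ρ),
      essInf (fun ξ => (ω ξ : ℝ≥0∞)) (arcLength.restrict (closedBall ξ ρ)) ≤ ω ζ := by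
    have h2 : ∀ᵐ ζ ∂arcLength.restrict (closedBall ξ ρ),
      essInf (fun ξ => (ω ξ : ℝ≥0∞)) (arcLength.restrict (closedBall ξ ρ)) ≤ ω ζ := ae_essInf_le
    refine Measure.AbsolutelyContinuous.ae_le ?_ h2
    rw [normArcLength, Measure.restrict_smul]
    exact Measure.smul_absolutelyContinuous
  filter_upwards [h1] with ζ hζ
  have h3 := measure_mul_laverage (arcLength.restrict (closedBall ξ ρ)) (fun ξ => (ω ξ : ℝ≥0∞))
  rw [Measure.restrict_apply_univ] at h3
  calc ∫⁻ x in closedBall ξ ρ, ω x ∂normArcLength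
      = (ENNReal.ofReal (2 * π))⁻¹ * ∫⁻ x in closedBall ξ ρ, ω x ∂arcLength := by
        rw [normArcLength, Measure.restrict_smul, lintegral_smul_measure, smul_eq_mul]
    _ = normArcLength (closedBall ξ ρ) * ⨍⁻ x in closedBall ξ ρ, ω x ∂arcLength := by
        rw [← h3, normArcLength_apply, mul_assoc]
    _ ≤ ENNReal.ofReal ρ * (A * ω ζ) := by
        gcongr
        · exact normArcLength_closedBall_le ξ ρ
        · exact (hA _ (isArc_closedBall ξ hρ)).trans (by gcongr)
    _ = _ := by ring

theorem tsum_rpow_le_rpow_tsum {ι : Type*} (a : ι → ℝ≥0∞) {t : ℝ} (ht : 1 ≤ t) :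
    ∑' i, a i ^ t ≤ (∑' i, a i) ^ t := by
  have key : ∀ x : ℝ≥0∞, x ^ t = x * x ^ (t - 1) := fun x => by
    conv_lhs => rw [← add_sub_cancel 1 t]
    rw [ENNReal.rpow_add_of_nonneg _ _ zero_le_one (by linarith), ENNReal.rpow_one]
  rw [key (∑' i, a i), ← ENNReal.tsum_mul_right]
  refine ENNReal.tsum_le_tsum fun i => ?_
  rw [key]
  gcongr
  exact ENNReal.le_tsum i

section CarlesonEstimate

variable {X : Type*} [MeasurableSpace X] {ν : Measure X} {η : X → Circle} {δ : X → ℝ}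
  {w : Circle → ℝ≥0∞} {t : ℝ} {A : ℝ≥0∞}

/-- Weak type estimate. A point `x` of the space `X` has a direction `η x` on the circle and a height
`δ x`, and only averages at scales `ρ ≥ δ x` count for `x`. The hypothesis `H` combines the Carleson
condition on `ν` with the `A₁` condition on `w`; the choice `X = Circle`, `δ = 0` is the classical
maximal function, the choice `X = Disk`, `δ z = 1 - |z|` is the setting of Carleson embeddings.
Only radii `ρ ≤ 2` occur, as a ball of radius `2` is the whole circle. -/
theorem measure_exists_lt_setLIntegral_le (ht : 1 ≤ t)
    (H : ∀ (ξ : Circle) (ρ : ℝ), 0 < ρ → ∀ᵐ ζ ∂normArcLength.restrict (closedBall ξ ρ),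
      ν {x | dist (η x) ξ ≤ 3 * ρ ∧ δ x ≤ 2 * ρ} ≤ (A * ENNReal.ofReal ρ * w ζ) ^ t)
    (hw : Measurable w) {g : Circle → ℝ≥0∞} (hg : Measurable g) {l : ℝ≥0∞} (hl0 : l ≠ 0)
    (hl : l ≠ ∞) :
    ν {x | ∃ ρ, 0 < ρ ∧ ρ ≤ 2 ∧ δ x ≤ ρ ∧
      l * ENNReal.ofReal ρ < ∫⁻ ζ in closedBall (η x) ρ, g ζ ∂normArcLength} ≤
      (l⁻¹ * A * ∫⁻ ζ, g ζ * w ζ ∂normArcLength) ^ t := by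
  have ht0 : 0 < t := by linarith
  let S : Set (Circle × ℝ) := {p | 0 < p.2 ∧ p.2 ≤ 2 ∧
    l * ENNReal.ofReal p.2 < ∫⁻ ζ in closedBall p.1 p.2, g ζ ∂normArcLength}
  let B : Circle × ℝ → Set Circle := fun p => closedBall p.1 p.2
  obtain ⟨u, hu, hdis, hcov⟩ := Vitali.exists_disjoint_subfamily_covering_enlargement B S
    (fun p => p.2) 2 (by norm_num) (fun p hp => hp.1.le) 2 (fun p hp => hp.2.1)
    (fun p hp => nonempty_closedBall.2 hp.1.le)
  have hcount : u.Countable := hdis.countable_of_nonempty_interior fun p hp =>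
    ⟨p.1, ball_subset_interior_closedBall (mem_ball_self (hu hp).1)⟩
  have : Countable u := hcount.to_subtype
  let T : Circle × ℝ → Set X := fun p => {x | dist (η x) p.1 ≤ 3 * p.2 ∧ δ x ≤ 2 * p.2}
  -- The bound `H` holds at almost every point of the ball, so it can be integrated against `g`.
  have hT : ∀ p ∈ u, ν (T p) ≤ (l⁻¹ * A * ∫⁻ ζ in B p, g ζ * w ζ ∂normArcLength) ^ t := by
    intro p hp
    obtain ⟨h0, -, hlt⟩ := hu hp
    rw [← ENNReal.rpow_inv_le_iff ht0]
    set N := ν (T p) ^ t⁻¹ with hN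
    have h1 : N * ∫⁻ ζ in B p, g ζ ∂normArcLength ≤
        A * ENNReal.ofReal p.2 * ∫⁻ ζ in B p, g ζ * w ζ ∂normArcLength := by
      rw [← lintegral_const_mul _ hg, ← lintegral_const_mul (A * ENNReal.ofReal p.2)
        (show Measurable fun ζ => g ζ * w ζ from hg.mul hw)]
      apply lintegral_mono_ae
      filter_upwards [H p.1 p.2 h0] with ζ hζ
      rw [← ENNReal.rpow_inv_le_iff ht0] at hζ
      calc N * g ζ ≤ (A * ENNReal.ofReal p.2 * w ζ) * g ζ := by gcongr
        _ = _ := by ring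
    have h2 : (N * l) * ENNReal.ofReal p.2 ≤
        (A * ∫⁻ ζ in B p, g ζ * w ζ ∂normArcLength) * ENNReal.ofReal p.2 := by
      calc _ = N * (l * ENNReal.ofReal p.2) := by ring
        _ ≤ N * ∫⁻ ζ in B p, g ζ ∂normArcLength := by gcongr
        _ ≤ _ := h1
        _ = _ := by ring
    rw [ENNReal.mul_le_mul_iff_left (by simpa using h0) ENNReal.ofReal_ne_top] at h2
    calc N = l⁻¹ * (N * l) := by
          rw [mul_comm N, ← mul_assoc, ENNReal.inv_mul_cancel hl0 hl, one_mul]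
      _ ≤ l⁻¹ * (A * ∫⁻ ζ in B p, g ζ * w ζ ∂normArcLength) := by gcongr
      _ = _ := by ring
  calc _ ≤ ν (⋃ p ∈ u, T p) := by
        apply measure_mono
        rintro x ⟨ρ, h0, h2, hδ, hlt⟩
        obtain ⟨b, hb, ⟨y, hy1, hy2⟩, hle⟩ := hcov (η x, ρ) ⟨h0, h2, hlt⟩
        refine mem_biUnion hb ⟨?_, hδ.trans hle⟩
        have h3 : dist y (η x) ≤ ρ := hy1
        have h4 : dist y b.1 ≤ b.2 := hy2
        have h5 : ρ ≤ 2 * b.2 := hle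
        linarith [dist_triangle_left (η x) b.1 y]
    _ ≤ ∑' p : u, ν (T p) := measure_biUnion_le _ hcount _
    _ ≤ ∑' p : u, (l⁻¹ * A * ∫⁻ ζ in B p, g ζ * w ζ ∂normArcLength) ^ t :=
        ENNReal.tsum_le_tsum fun p => hT p p.2
    _ ≤ (∑' p : u, (l⁻¹ * A * ∫⁻ ζ in B p, g ζ * w ζ ∂normArcLength)) ^ t :=
        tsum_rpow_le_rpow_tsum _ ht
    _ = (l⁻¹ * A * ∫⁻ ζ in ⋃ p ∈ u, B p, g ζ * w ζ ∂normArcLength) ^ t := by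
        rw [ENNReal.tsum_mul_left, lintegral_biUnion hcount
          (fun p _ => isClosed_closedBall.measurableSet) hdis]
    _ ≤ _ := by
        gcongr
        exact Measure.restrict_le_self

/-- Integrating the truncations `g · 1_{g > l}` over all levels `l > 0` gives back `g²`. -/
theorem lintegral_Ioi_indicator_lt_le (hw : Measurable w) {g : Circle → ℝ≥0∞}
    (hg : Measurable g) :
    ∫⁻ l in Ioi (0 : ℝ), ∫⁻ ζ, {ζ | ENNReal.ofReal l < g ζ}.indicator g ζ * w ζ ∂normArcLength ≤
      ∫⁻ ζ, g ζ ^ 2 * w ζ ∂normArcLength := by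
  have hms : MeasurableSet {p : ℝ × Circle | ENNReal.ofReal p.1 < g p.2} :=
    measurableSet_lt (by fun_prop) (by fun_prop)
  have hm : Measurable fun p : ℝ × Circle =>
      {p : ℝ × Circle | ENNReal.ofReal p.1 < g p.2}.indicator (fun p => g p.2) p * w p.2 :=
    (Measurable.indicator (by fun_prop) hms).mul (by fun_prop)
  rw [lintegral_lintegral_swap (f := fun l ζ => {ζ | ENNReal.ofReal l < g ζ}.indicator g ζ * w ζ)
    hm.aemeasurable]
  apply lintegral_mono
  intro ζ
  calc ∫⁻ l in Ioi (0 : ℝ), {ζ | ENNReal.ofReal l < g ζ}.indicator g ζ * w ζ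
      = ∫⁻ l in Ioi (0 : ℝ), {l : ℝ | ENNReal.ofReal l < g ζ}.indicator (fun _ => g ζ * w ζ) l := by
        congr with l
        by_cases h : ENNReal.ofReal l < g ζ <;> simp [h]
    _ = g ζ * w ζ * volume ({l : ℝ | ENNReal.ofReal l < g ζ} ∩ Ioi 0) := by
        have hms' : MeasurableSet {l : ℝ | ENNReal.ofReal l < g ζ} :=
          measurableSet_lt (by fun_prop) (by fun_prop)
        rw [lintegral_indicator hms', setLIntegral_const, Measure.restrict_apply hms']
    _ ≤ g ζ * w ζ * g ζ := by
        gcongr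
        rcases eq_or_ne (g ζ) ∞ with h | h
        · rw [h]; exact le_top
        · calc _ ≤ volume (Ioo 0 (g ζ).toReal) := by
                apply measure_mono
                rintro l ⟨h1, h2⟩
                exact ⟨h2, by
                  simpa [ENNReal.toReal_ofReal (le_of_lt h2)] using
                    (ENNReal.toReal_lt_toReal ENNReal.ofReal_ne_top h).2 h1⟩
            _ = g ζ := by rw [Real.volume_Ioo, sub_zero, ENNReal.ofReal_toReal h]
    _ = _ := by ring

/-- Strong type estimate, obtained by integrating the weak type estimate over the levels: if `h` is
controlled by the averages of `g`, then `∫ h^(2t) dν` is at most a constant times `(∫ g² w)^t`. The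
constant is explicit because it has to be uniform in `h`. -/
theorem lintegral_rpow_le_of_forall_setLIntegral_le (ht : 1 ≤ t)
    (H : ∀ (ξ : Circle) (ρ : ℝ), 0 < ρ → ∀ᵐ ζ ∂normArcLength.restrict (closedBall ξ ρ),
      ν {x | dist (η x) ξ ≤ 3 * ρ ∧ δ x ≤ 2 * ρ} ≤ (A * ENNReal.ofReal ρ * w ζ) ^ t)
    (hw : Measurable w) {g : Circle → ℝ≥0∞} (hg : Measurable g) {h : X → ℝ}
    (hm : AEMeasurable h ν) (h0 : ∀ x, 0 ≤ h x) {c : ℝ} (hc : 0 < c)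
    (hh : ∀ x (l : ℝ), 0 < l → (∀ ρ, 0 < ρ → ρ ≤ 2 → δ x ≤ ρ →
      ∫⁻ ζ in closedBall (η x) ρ, g ζ ∂normArcLength ≤ ENNReal.ofReal l * ENNReal.ofReal ρ) →
      h x ≤ c * l) :
    ∫⁻ x, ENNReal.ofReal (h x ^ (2 * t)) ∂ν ≤
      ENNReal.ofReal ((2 * c) ^ (2 * t) * (2 * t)) * A ^ t *
        (∫⁻ ζ, g ζ ^ 2 * w ζ ∂normArcLength) ^ t := by
  have ht0 : 0 < t := by linarith
  set G := ∫⁻ ζ, g ζ ^ 2 * w ζ ∂normArcLength with hG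
  let b : ℝ → ℝ≥0∞ := fun l =>
    ∫⁻ ζ, {ζ | ENNReal.ofReal l < g ζ}.indicator g ζ * w ζ ∂normArcLength
  -- If `h x > 2 c l` then some average of `g` exceeds `2 l`, and discarding the values of `g` below
  -- `l` costs at most `l` in the average.
  have hlevel : ∀ l : ℝ, 0 < l → ν {x | l < h x / (2 * c)} ≤
      ((ENNReal.ofReal l)⁻¹ * A * b l) ^ t := by
    intro l hl
    have hms : MeasurableSet {ζ | ENNReal.ofReal l < g ζ} :=
      measurableSet_lt measurable_const hg
    refine le_trans (measure_mono ?_) (measure_exists_lt_setLIntegral_le ht H hw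
      (hg.indicator hms) (l := ENNReal.ofReal l) (by simpa using hl) ENNReal.ofReal_ne_top)
    intro x hx
    have hx' : l < h x / (2 * c) := hx
    rw [lt_div_iff₀ (by positivity)] at hx'
    have hnot : ¬ h x ≤ c * (2 * l) := by rw [not_le]; linarith
    have := mt (hh x (2 * l) (by positivity)) hnot
    push Not at this
    obtain ⟨ρ, hρ0, hρ2, hδ, hlt⟩ := this
    refine ⟨ρ, hρ0, hρ2, hδ, ?_⟩
    by_contra hle
    rw [not_lt] at hle
    refine absurd hlt (not_lt.2 ?_)
    calc ∫⁻ ζ in closedBall (η x) ρ, g ζ ∂normArcLength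
        ≤ ∫⁻ ζ in closedBall (η x) ρ, ({ζ | ENNReal.ofReal l < g ζ}.indicator g ζ +
            ENNReal.ofReal l) ∂normArcLength := by
          apply lintegral_mono
          intro ζ
          by_cases hζ : ENNReal.ofReal l < g ζ
          · simp [hζ]
          · simp [hζ, not_lt.1 hζ]
      _ = ∫⁻ ζ in closedBall (η x) ρ, {ζ | ENNReal.ofReal l < g ζ}.indicator g ζ ∂normArcLength +
            ENNReal.ofReal l * normArcLength (closedBall (η x) ρ) := by
          rw [lintegral_add_right _ measurable_const, setLIntegral_const]
      _ ≤ ENNReal.ofReal l * ENNReal.ofReal ρ + ENNReal.ofReal l * ENNReal.ofReal ρ := by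
          gcongr
          exact normArcLength_closedBall_le _ _
      _ = _ := by
          rw [ENNReal.ofReal_mul zero_le_two, ENNReal.ofReal_ofNat]; ring
  have hbG : ∀ l : ℝ, 0 < l → ENNReal.ofReal l * b l ≤ G := by
    intro l hl
    rw [← lintegral_const_mul' _ _ ENNReal.ofReal_ne_top]
    apply lintegral_mono
    intro ζ
    by_cases hζ : ENNReal.ofReal l < g ζ
    · beta_reduce
      rw [indicator_of_mem (show ζ ∈ {ζ | ENNReal.ofReal l < g ζ} from hζ)]
      rw [← mul_assoc, sq]
      gcongr
    · simp [hζ]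
  -- `b l ^ t = b l ^ (t - 1) * b l` and `l * b l ≤ G` leave an integrand that is linear in `b`.
  have hpt : ∀ l : ℝ, 0 < l → ν {x | l < h x / (2 * c)} * ENNReal.ofReal (l ^ (2 * t - 1)) ≤
      A ^ t * G ^ (t - 1) * b l := by
    intro l hl
    have hl0 : ENNReal.ofReal l ≠ 0 := by simpa using hl
    rw [← ENNReal.ofReal_rpow_of_pos hl]
    calc _ ≤ ((ENNReal.ofReal l)⁻¹ * A * b l) ^ t * ENNReal.ofReal l ^ (2 * t - 1) := by
          gcongr; exact hlevel l hl
      _ = A ^ t * ((ENNReal.ofReal l) ^ (-t) * ENNReal.ofReal l ^ (2 * t - 1)) * b l ^ t := by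
          rw [ENNReal.mul_rpow_of_nonneg _ _ ht0.le, ENNReal.mul_rpow_of_nonneg _ _ ht0.le,
            ENNReal.inv_rpow, ENNReal.rpow_neg]
          ring
      _ = A ^ t * (ENNReal.ofReal l) ^ (t - 1) * (b l ^ (t - 1) * b l ^ (1 : ℝ)) := by
          rw [← ENNReal.rpow_add _ _ hl0 ENNReal.ofReal_ne_top,
            ← ENNReal.rpow_add_of_nonneg _ _ (by linarith) zero_le_one]
          congr 3 <;> ring
      _ = A ^ t * (ENNReal.ofReal l * b l) ^ (t - 1) * b l := by
          rw [ENNReal.mul_rpow_of_nonneg _ _ (by linarith), ENNReal.rpow_one]; ring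
      _ ≤ _ := by
          gcongr
          exact hbG l hl
  have hscale : ∀ x, ENNReal.ofReal (h x ^ (2 * t)) =
      ENNReal.ofReal ((2 * c) ^ (2 * t)) * ENNReal.ofReal ((h x / (2 * c)) ^ (2 * t)) := by
    intro x
    rw [← ENNReal.ofReal_mul (by positivity), ← Real.mul_rpow (by positivity)
      (div_nonneg (h0 x) (by positivity)), mul_div_cancel₀ _ (by positivity)]
  simp_rw [hscale]
  rw [lintegral_const_mul' _ _ ENNReal.ofReal_ne_top,
    lintegral_rpow_eq_lintegral_meas_lt_mul ν
      (ae_of_all _ fun x => div_nonneg (h0 x) (by positivity)) (hm.div_const _) (by positivity),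
    ENNReal.ofReal_mul (p := (2 * c) ^ (2 * t)) (by positivity)]
  calc _ ≤ ENNReal.ofReal ((2 * c) ^ (2 * t)) * (ENNReal.ofReal (2 * t) *
        ∫⁻ l in Ioi (0 : ℝ), A ^ t * G ^ (t - 1) * b l) := by
        refine mul_le_mul_right (mul_le_mul_right ?_ _) _
        exact setLIntegral_mono' measurableSet_Ioi hpt
    _ ≤ ENNReal.ofReal ((2 * c) ^ (2 * t)) * (ENNReal.ofReal (2 * t) *
        (A ^ t * G ^ (t - 1) * G)) := by
        have hbm : Measurable b := by
          have hms : MeasurableSet {p : ℝ × Circle | ENNReal.ofReal p.1 < g p.2} :=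
            measurableSet_lt (by fun_prop) (by fun_prop)
          have hm : Measurable fun p : ℝ × Circle =>
              {p : ℝ × Circle | ENNReal.ofReal p.1 < g p.2}.indicator (fun p => g p.2) p * w p.2 :=
            (Measurable.indicator (by fun_prop) hms).mul (by fun_prop)
          exact hm.lintegral_prod_right'
        rw [lintegral_const_mul _ hbm]
        gcongr
        exact lintegral_Ioi_indicator_lt_le hw hg
    _ = _ := by
        have : G ^ t = G ^ (t - 1) * G := by
          conv_rhs => rw [← ENNReal.rpow_one G, ← ENNReal.rpow_mul, one_mul]
          rw [← ENNReal.rpow_add_of_nonneg _ _ (by linarith) zero_le_one, sub_add_cancel]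
        rw [this]; ring

end CarlesonEstimate

/-! ### Poisson integrals and subharmonicity -/

/-- The Poisson kernel `P_z(ξ) = (1 - |z|²) / |ξ - z|²` of the unit disk. -/
noncomputable def poisson (z : ℂ) (ξ : Circle) : ℝ := (1 - ‖z‖ ^ 2) / ‖(ξ : ℂ) - z‖ ^ 2

theorem continuous_coe_circle : Continuous fun ξ : Circle => (ξ : ℂ) := by fun_prop

theorem coe_mem_closedBall (ξ : Circle) : (ξ : ℂ) ∈ closedBall (0 : ℂ) 1 :=
  mem_closedBall_zero_iff.2 (Circle.norm_coe ξ).le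

theorem one_sub_norm_le (z : ℂ) (ξ : Circle) : 1 - ‖z‖ ≤ ‖(ξ : ℂ) - z‖ := by
  have := norm_sub_norm_le (ξ : ℂ) z
  rwa [Circle.norm_coe] at this

theorem circle_sub_norm_pos {z : ℂ} (hz : ‖z‖ < 1) (ξ : Circle) : 0 < ‖(ξ : ℂ) - z‖ :=
  lt_of_lt_of_le (by linarith) (one_sub_norm_le z ξ)

theorem poisson_nonneg {z : ℂ} (hz : ‖z‖ < 1) (ξ : Circle) : 0 ≤ poisson z ξ := by
  have : ‖z‖ ^ 2 ≤ 1 := pow_le_one₀ (norm_nonneg z) hz.le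
  exact div_nonneg (by linarith) (by positivity)

theorem continuous_poisson {z : ℂ} (hz : ‖z‖ < 1) : Continuous (poisson z) := by
  unfold poisson
  refine Continuous.div continuous_const (by fun_prop) fun ξ => ?_
  exact pow_ne_zero 2 (circle_sub_norm_pos hz ξ).ne'

theorem poisson_le {z : ℂ} (hz : ‖z‖ < 1) (ξ : Circle) :
    poisson z ξ ≤ 2 * (1 - ‖z‖) / ‖(ξ : ℂ) - z‖ ^ 2 := by
  unfold poisson
  gcongr
  nlinarith [norm_nonneg z]

theorem poisson_le_const {z : ℂ} (hz : ‖z‖ < 1) (ξ : Circle) : poisson z ξ ≤ 2 / (1 - ‖z‖) := by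
  refine (poisson_le hz ξ).trans ?_
  have h1 := one_sub_norm_le z ξ
  have h2 : 0 < 1 - ‖z‖ := by linarith
  calc _ ≤ 2 * (1 - ‖z‖) / (1 - ‖z‖) ^ 2 := by gcongr
    _ = _ := by field_simp

theorem integral_poisson_smul {f : ℂ → ℂ} (hf : DiffContOnCl ℂ f (ball 0 1)) {z : ℂ} (hz : ‖z‖ < 1) :
    ∫ ξ, poisson z ξ • f ξ ∂normArcLength = f z := by
  have h := hf.circleAverage_poissonKernel_smul (w := z) (by simpa using hz)
  rw [← h]
  have hc : Continuous fun ξ : Circle => f ξ := by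
    refine hf.continuousOn.comp_continuous continuous_coe_circle fun ξ => ?_
    rw [closure_ball _ one_ne_zero]
    exact coe_mem_closedBall ξ
  have he : ∀ ξ : Circle, (poissonKernel 0 z • f) ξ = poisson z ξ • f ξ := fun ξ => by
    simp only [Pi.smul_apply', poissonKernel_def, poisson, sub_zero, Circle.norm_coe, one_pow]
  rw [← integral_normArcLength]
  · simp_rw [he]
  · simp_rw [he]
    exact (continuous_poisson hz).smul hc

theorem lintegral_poisson {z : ℂ} (hz : ‖z‖ < 1) :
    ∫⁻ ξ, ENNReal.ofReal (poisson z ξ) ∂normArcLength = 1 := by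
  have hi : Integrable (poisson z) normArcLength :=
    (continuous_poisson hz).integrable_of_hasCompactSupport (HasCompactSupport.of_compactSpace _)
  rw [← ofReal_integral_eq_lintegral_ofReal hi (ae_of_all _ (poisson_nonneg hz))]
  have := integral_poisson_smul (f := fun _ => 1) diffContOnCl_const hz
  simp only [Complex.real_smul, mul_one] at this
  rw [integral_complex_ofReal] at this
  rw [Complex.ofReal_eq_one.1 this, ENNReal.ofReal_one]

/-- If `ξ` is the direction of `z` up to a distance comparable to `1 - |z|`, the Poisson integral of
`g` at `z` is dominated by the averages of `g` over the balls about `ξ` of radius at least `1 - |z|`.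
The Poisson kernel is at most `72 / (1 - |z|)` times the sum over `k` of `4^(-k)` times the indicator
function of the ball of radius `2^k (1 - |z|)`. -/
theorem lintegral_poisson_mul_le {z : ℂ} (hz : ‖z‖ < 1) {ξ : Circle}
    (hξ : ∀ ζ : Circle, dist ζ ξ ≤ 3 * ‖(ζ : ℂ) - z‖) {g : Circle → ℝ≥0∞}
    (hg : AEMeasurable g normArcLength) {M : ℝ≥0∞}
    (hM : ∀ ρ, 1 - ‖z‖ ≤ ρ → ρ ≤ 2 →
      ∫⁻ ζ in closedBall ξ ρ, g ζ ∂normArcLength ≤ M * ENNReal.ofReal ρ) :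
    ∫⁻ ζ, ENNReal.ofReal (poisson z ζ) * g ζ ∂normArcLength ≤ 144 * M := by
  set d := 1 - ‖z‖ with hd
  have hd0 : 0 < d := by linarith
  have hM' : ∀ ρ, d ≤ ρ → ∫⁻ ζ in closedBall ξ ρ, g ζ ∂normArcLength ≤ M * ENNReal.ofReal ρ := by
    intro ρ hρ
    rcases le_total ρ 2 with h | h
    · exact hM ρ hρ h
    · rw [closedBall_eq_univ h, ← closedBall_eq_univ (ξ := ξ) le_rfl]
      refine (hM 2 (by linarith [norm_nonneg z]) le_rfl).trans ?_
      gcongr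
  let c : ℕ → ℝ := fun k => 72 / d * (1 / 4) ^ k
  have hpt : ∀ ζ, ENNReal.ofReal (poisson z ζ) * g ζ ≤
      ∑' k, ENNReal.ofReal (c k) * (closedBall ξ (2 ^ k * d)).indicator g ζ := by
    intro ζ
    -- Take the least `k` such that the ball of radius `2 ^ k * d` contains `ζ`.
    obtain ⟨k, hk, hck⟩ : ∃ k : ℕ, ζ ∈ closedBall ξ (2 ^ k * d) ∧ poisson z ζ ≤ c k := by
      have hex : ∃ k : ℕ, dist ζ ξ ≤ 2 ^ k * d := by
        obtain ⟨k, hk⟩ := pow_unbounded_of_one_lt (dist ζ ξ / d) one_lt_two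
        exact ⟨k, ((div_lt_iff₀ hd0).1 hk).le⟩
      classical
      refine ⟨Nat.find hex, Nat.find_spec hex, ?_⟩
      rcases hkk : Nat.find hex with _ | j
      · refine (poisson_le_const hz ζ).trans ?_
        simp only [c, pow_zero, mul_one]
        gcongr
        norm_num
      · have hj : ¬ dist ζ ξ ≤ 2 ^ j * d := Nat.find_min hex (by omega)
        rw [not_le] at hj
        have h3 : 2 ^ j * d / 3 ≤ ‖(ζ : ℂ) - z‖ := by linarith [hξ ζ]
        refine (poisson_le hz ζ).trans ?_
        calc 2 * (1 - ‖z‖) / ‖(ζ : ℂ) - z‖ ^ 2 ≤ 2 * d / (2 ^ j * d / 3) ^ 2 := by gcongr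
          _ = c (j + 1) := by
            simp only [c]
            rw [pow_succ (1 / 4 : ℝ), div_pow 1 (4 : ℝ), one_pow,
              show (4 : ℝ) ^ j = (2 ^ j) ^ 2 by rw [← pow_mul, mul_comm, pow_mul]; norm_num]
            field_simp
            norm_num
    refine le_trans ?_ (ENNReal.le_tsum k)
    rw [indicator_of_mem hk]
    gcongr
  have hcpos : ∀ k, 0 < c k := fun k => by positivity
  calc _ ≤ ∫⁻ ζ, ∑' k, ENNReal.ofReal (c k) *
        (closedBall ξ (2 ^ k * d)).indicator g ζ ∂normArcLength := lintegral_mono hpt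
    _ = ∑' k, ENNReal.ofReal (c k) * ∫⁻ ζ in closedBall ξ (2 ^ k * d), g ζ ∂normArcLength := by
        rw [lintegral_tsum fun k =>
          (hg.indicator isClosed_closedBall.measurableSet).const_mul _]
        congr with k
        rw [lintegral_const_mul' _ _ ENNReal.ofReal_ne_top,
          lintegral_indicator isClosed_closedBall.measurableSet]
    _ ≤ ∑' k : ℕ, ENNReal.ofReal (72 * (1 / 2) ^ k) * M := by
        refine ENNReal.tsum_le_tsum fun k => ?_
        calc _ ≤ ENNReal.ofReal (c k) * (M * ENNReal.ofReal (2 ^ k * d)) := by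
              gcongr
              exact hM' _ (le_mul_of_one_le_left hd0.le (one_le_pow₀ one_le_two))
          _ = ENNReal.ofReal (c k * (2 ^ k * d)) * M := by
              rw [ENNReal.ofReal_mul (hcpos k).le]; ring
          _ = _ := by
              congr 2
              simp only [c]
              rw [show (1 / 4 : ℝ) ^ k = (1 / 2) ^ k * (1 / 2) ^ k by rw [← mul_pow]; norm_num]
              have : (1 / 2 : ℝ) ^ k * 2 ^ k = 1 := by rw [← mul_pow]; norm_num
              field_simp
              linear_combination this
    _ = _ := by
        rw [ENNReal.tsum_mul_right]
        congr 1
        rw [← ENNReal.ofReal_tsum_of_nonneg (fun k => by positivity)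
          (summable_geometric_two.mul_left 72), tsum_mul_left, tsum_geometric_two]
        norm_num

theorem norm_one_sub_conj_mul_sq (u z : ℂ) :
    ‖1 - (starRingEnd ℂ) u * z‖ ^ 2 = ‖z - u‖ ^ 2 + (1 - ‖z‖ ^ 2) * (1 - ‖u‖ ^ 2) := by
  simp only [Complex.sq_norm, Complex.normSq_apply]
  simp
  ring

/-- The principal power `(1 - a z)^s` is analytic in the disk and continuous up to the boundary for
`|a| ≤ 1`, as `1 - a z` has nonnegative real part there and `s > 0` gives continuity at zeros. -/
theorem diffContOnCl_one_sub_mul_cpow {a : ℂ} (ha : ‖a‖ ≤ 1) {s : ℝ} (hs : 0 < s) :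
    DiffContOnCl ℂ (fun z => (1 - a * z) ^ (s : ℂ)) (ball 0 1) := by
  have hre : ∀ z : ℂ, (a * z).re ≤ ‖z‖ := fun z => (Complex.re_le_norm _).trans (by
    rw [norm_mul]; exact mul_le_of_le_one_left (norm_nonneg z) ha)
  constructor
  · intro z hz
    have hz' : ‖z‖ < 1 := by simpa using hz
    refine (DifferentiableAt.cpow (by fun_prop) (by fun_prop) (Or.inl ?_)).differentiableWithinAt
    simp only [Complex.sub_re, Complex.one_re]
    linarith [hre z]
  · rw [closure_ball _ one_ne_zero]
    intro z hz
    have hz' : ‖z‖ ≤ 1 := by simpa using hz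
    have hcont : ContinuousAt (fun x : ℂ => x ^ (s : ℂ)) (1 - a * z) := by
      rcases eq_or_ne (1 - a * z) 0 with h0 | h0
      · rw [h0]
        have := Complex.continuousAt_cpow_zero_of_re_pos (z := (s : ℂ)) (by simpa using hs)
        exact ContinuousAt.comp (f := fun x : ℂ => (x, (s : ℂ)))
          (g := fun p : ℂ × ℂ => p.1 ^ p.2) this (by fun_prop)
      · refine continuousAt_id.cpow continuousAt_const ?_
        rw [id, Complex.mem_slitPlane_iff]
        by_contra! hcon
        have h1 := hre z
        have h2 : 0 ≤ (1 - a * z).re := by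
          simp only [Complex.sub_re, Complex.one_re]; linarith
        exact h0 (Complex.ext (le_antisymm hcon.1 h2) hcon.2)
    exact (ContinuousAt.comp (f := fun z => 1 - a * z) hcont (by fun_prop)).continuousWithinAt

open Polynomial in
/-- Reflecting the zeros of a polynomial `p` that lie in the disk gives a function without zeros in
the disk, whose `s`-th power `G` satisfies `|p|^s ≤ |G|` in the disk with equality on the circle. -/
theorem exists_diffContOnCl_norm_eval_rpow_le (p : ℂ[X]) {s : ℝ} (hs : 0 < s) :
    ∃ G : ℂ → ℂ, DiffContOnCl ℂ G (ball 0 1) ∧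
      (∀ z, ‖z‖ ≤ 1 → ‖p.eval z‖ ^ s ≤ ‖G z‖) ∧ ∀ z, ‖z‖ = 1 → ‖G z‖ = ‖p.eval z‖ ^ s := by
  have hlin : ∀ u : ℂ, ∃ G : ℂ → ℂ, DiffContOnCl ℂ G (ball 0 1) ∧
      (∀ z, ‖z‖ ≤ 1 → ‖z - u‖ ^ s ≤ ‖G z‖) ∧ ∀ z, ‖z‖ = 1 → ‖G z‖ = ‖z - u‖ ^ s := by
    intro u
    -- A zero `u` in the closed disk is reflected: the factor `z - u` becomes `1 - ū z`. A zero outside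
    -- only needs `z - u = -u (1 - u⁻¹ z)`.
    rcases le_total ‖u‖ 1 with hu | hu
    · refine ⟨_, diffContOnCl_one_sub_mul_cpow (a := (starRingEnd ℂ) u) (by simpa using hu) hs,
        fun z hz => ?_, fun z hz => ?_⟩
      · rw [Complex.norm_cpow_real]
        refine Real.rpow_le_rpow (norm_nonneg _) ?_ hs.le
        refine (sq_le_sq₀ (norm_nonneg _) (norm_nonneg _)).1 ?_
        rw [norm_one_sub_conj_mul_sq]
        have h1 : ‖z‖ ^ 2 ≤ 1 := pow_le_one₀ (norm_nonneg z) hz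
        have h2 : ‖u‖ ^ 2 ≤ 1 := pow_le_one₀ (norm_nonneg u) hu
        nlinarith
      · rw [Complex.norm_cpow_real]
        congr 1
        refine (pow_left_inj₀ (norm_nonneg _) (norm_nonneg _) two_ne_zero).1 ?_
        rw [norm_one_sub_conj_mul_sq, hz]; ring
    · have hu0 : u ≠ 0 := by rw [← norm_pos_iff]; linarith
      have he : ∀ z, ‖((‖u‖ ^ s : ℝ) : ℂ) • (1 - u⁻¹ * z) ^ (s : ℂ)‖ = ‖z - u‖ ^ s := by
        intro z
        rw [norm_smul, Complex.norm_cpow_real, Complex.norm_real, Real.norm_of_nonneg (by positivity),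
          ← Real.mul_rpow (norm_nonneg _) (norm_nonneg _), ← norm_mul, mul_sub,
          mul_inv_cancel_left₀ hu0, mul_one, norm_sub_rev]
      exact ⟨_, (diffContOnCl_one_sub_mul_cpow (a := u⁻¹)
        (by rw [norm_inv]; exact inv_le_one_of_one_le₀ hu) hs).const_smul ((‖u‖ ^ s : ℝ) : ℂ),
        fun z _ => (he z).ge, fun z _ => he z⟩
  have hprod : ∀ S : Multiset ℂ, ∃ G : ℂ → ℂ, DiffContOnCl ℂ G (ball 0 1) ∧
      (∀ z, ‖z‖ ≤ 1 → ‖(S.map fun a => X - C a).prod.eval z‖ ^ s ≤ ‖G z‖) ∧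
      ∀ z, ‖z‖ = 1 → ‖G z‖ = ‖(S.map fun a => X - C a).prod.eval z‖ ^ s := by
    intro S
    induction S using Multiset.induction with
    | empty => exact ⟨fun _ => 1, diffContOnCl_const, by simp, by simp⟩
    | cons u S ih =>
      obtain ⟨G, hG, h1, h2⟩ := ih
      obtain ⟨L, hL, h3, h4⟩ := hlin u
      refine ⟨fun z => L z • G z, hL.smul hG, fun z hz => ?_, fun z hz => ?_⟩
      · simp only [Multiset.map_cons, Multiset.prod_cons, eval_mul, eval_sub, eval_X, eval_C,
          norm_mul, norm_smul]
        rw [Real.mul_rpow (norm_nonneg _) (norm_nonneg _)]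
        exact mul_le_mul (h3 z hz) (h1 z hz) (by positivity) (norm_nonneg _)
      · simp only [Multiset.map_cons, Multiset.prod_cons, eval_mul, eval_sub, eval_X, eval_C,
          norm_mul, norm_smul]
        rw [Real.mul_rpow (norm_nonneg _) (norm_nonneg _), h4 z hz, h2 z hz]
  obtain ⟨G, hG, h1, h2⟩ := hprod p.roots
  have hp := (IsAlgClosed.splits p).eq_prod_roots
  have hev : ∀ z, ‖p.eval z‖ ^ s =
      ‖p.leadingCoeff‖ ^ s * ‖(p.roots.map fun a => X - C a).prod.eval z‖ ^ s := by
    intro z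
    conv_lhs => rw [hp]
    rw [eval_mul, eval_C, norm_mul, Real.mul_rpow (norm_nonneg _) (norm_nonneg _)]
  refine ⟨fun z => ((‖p.leadingCoeff‖ ^ s : ℝ) : ℂ) • G z, hG.const_smul ((‖p.leadingCoeff‖ ^ s : ℝ) : ℂ), fun z hz => ?_,
    fun z hz => ?_⟩
  · rw [norm_smul, Complex.norm_real, Real.norm_of_nonneg (by positivity), hev]
    gcongr
    exact h1 z hz
  · rw [norm_smul, Complex.norm_real, Real.norm_of_nonneg (by positivity), hev, h2 z hz]

theorem enorm_rpow_eq_ofReal (x : ℂ) {s : ℝ} (hs : 0 ≤ s) :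
    ‖x‖ₑ ^ s = ENNReal.ofReal (‖x‖ ^ s) := by
  rw [← ofReal_norm, ENNReal.ofReal_rpow_of_nonneg (norm_nonneg x) hs]

open Polynomial in
theorem enorm_eval_rpow_le (p : ℂ[X]) {s : ℝ} (hs : 0 < s) {w : ℂ} (hw : ‖w‖ < 1) :
    ‖p.eval w‖ₑ ^ s ≤ ∫⁻ ξ : Circle, ENNReal.ofReal (poisson w ξ) * ‖p.eval (ξ : ℂ)‖ₑ ^ s
      ∂normArcLength := by
  obtain ⟨G, hG, h1, h2⟩ := exists_diffContOnCl_norm_eval_rpow_le p hs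
  calc ‖p.eval w‖ₑ ^ s ≤ ‖G w‖ₑ := by
        rw [enorm_rpow_eq_ofReal _ hs.le, ← ofReal_norm]
        exact ENNReal.ofReal_le_ofReal (h1 w hw.le)
    _ = ‖∫ ξ, poisson w ξ • G ξ ∂normArcLength‖ₑ := by rw [integral_poisson_smul hG hw]
    _ ≤ ∫⁻ ξ, ‖poisson w ξ • G ξ‖ₑ ∂normArcLength := enorm_integral_le_lintegral_enorm _
    _ = _ := by
        congr with ξ
        rw [enorm_smul, Real.enorm_of_nonneg (poisson_nonneg hw ξ), enorm_rpow_eq_ofReal _ hs.le,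
          ← h2 ξ (Circle.norm_coe ξ), ofReal_norm]

theorem exists_polynomial_tendstoUniformlyOn {g : ℂ → ℂ} {R : ℝ} (hR : 1 < R)
    (hg : DifferentiableOn ℂ g (ball 0 R)) :
    ∃ q : ℕ → Polynomial ℂ,
      TendstoUniformlyOn (fun n z => (q n).eval z) g atTop (closedBall 0 1) := by
  obtain ⟨r, hr1, hrR⟩ := exists_between hR
  obtain ⟨r', hr1', hrr'⟩ := exists_between hr1
  lift r to ℝ≥0 using by linarith
  lift r' to ℝ≥0 using by linarith
  have hps := (hg.mono (closedBall_subset_ball hrR)).hasFPowerSeriesOnBall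
    (by exact_mod_cast (zero_lt_one.trans hr1))
  set P := cauchyPowerSeries g 0 r
  have hu := hps.tendstoUniformlyOn (r' := r') (by exact_mod_cast hrr')
  simp only [zero_add] at hu
  refine ⟨fun n => ∑ k ∈ Finset.range n, Polynomial.monomial k (P.coeff k),
    (hu.mono (closedBall_subset_ball hr1')).congr (Eventually.of_forall fun n z _ => ?_)⟩
  simp [FormalMultilinearSeries.partialSum, Polynomial.eval_finsetSum, mul_comm]

/-- `|g|^s` is subharmonic: it is dominated inside the disk by its Poisson integral. -/
theorem enorm_rpow_le_lintegral_poisson {g : ℂ → ℂ} {R : ℝ} (hR : 1 < R)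
    (hg : DifferentiableOn ℂ g (ball 0 R)) {s : ℝ} (hs : 0 < s) {w : ℂ} (hw : ‖w‖ < 1) :
    ‖g w‖ₑ ^ s ≤ ∫⁻ ξ : Circle, ENNReal.ofReal (poisson w ξ) * ‖g ξ‖ₑ ^ s ∂normArcLength := by
  obtain ⟨q, hq⟩ := exists_polynomial_tendstoUniformlyOn hR hg
  have hgc : ContinuousOn g (closedBall 0 1) := hg.continuousOn.mono (closedBall_subset_ball hR)
  obtain ⟨K, hK⟩ := (isCompact_closedBall (0 : ℂ) 1).exists_bound_of_continuousOn hgc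
  have hlim : ∀ z, ‖z‖ ≤ 1 → Tendsto (fun n => ‖(q n).eval z‖ₑ ^ s) atTop (𝓝 (‖g z‖ₑ ^ s)) := by
    intro z hz
    exact ((hq.tendsto_at (by simpa using hz)).enorm).ennrpow_const s
  refine le_of_tendsto_of_tendsto' (hlim w hw.le)
    (b := atTop)
    (tendsto_lintegral_filter_of_dominated_convergence
      (fun _ => ENNReal.ofReal (2 / (1 - ‖w‖)) * ENNReal.ofReal (K + 1) ^ s)
      (F := fun n ξ => ENNReal.ofReal (poisson w ξ) * ‖(q n).eval (ξ : ℂ)‖ₑ ^ s) ?_ ?_ ?_ ?_)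
    fun n => enorm_eval_rpow_le (q n) hs hw
  · refine Eventually.of_forall fun n => Measurable.mul ?_ ?_
    · exact (continuous_poisson hw).measurable.ennreal_ofReal
    · exact ((((q n).continuous.comp continuous_coe_circle).enorm).measurable).pow_const s
  · filter_upwards [(Metric.tendstoUniformlyOn_iff.1 hq) 1 one_pos] with n hn
    refine ae_of_all _ fun ξ => ?_
    gcongr
    · exact poisson_le_const hw ξ
    · rw [← ofReal_norm]
      apply ENNReal.ofReal_le_ofReal
      have h1 := hn ξ (coe_mem_closedBall ξ)
      rw [dist_comm, dist_eq_norm] at h1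
      have h2 := norm_sub_norm_le ((q n).eval (ξ : ℂ)) (g ξ)
      linarith [hK ξ (coe_mem_closedBall ξ)]
  · rw [lintegral_const]
    exact ENNReal.mul_ne_top (ENNReal.mul_ne_top ENNReal.ofReal_ne_top
      (ENNReal.rpow_ne_top_of_nonneg hs.le ENNReal.ofReal_ne_top)) (measure_ne_top _ _)
  · refine ae_of_all _ fun ξ => ?_
    exact ENNReal.Tendsto.const_mul (hlim ξ (Circle.norm_coe ξ).le) (Or.inr ENNReal.ofReal_ne_top)

/-! ### Weak limits and the radial maximal function of `H¹` -/

/-- Bounded sequences in a Hilbert space converge weakly along an ultrafilter, by the theorem of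
Banach and Alaoglu. -/
theorem exists_ultrafilter_tendsto_inner {𝕜 H : Type*} [RCLike 𝕜] [NormedAddCommGroup H]
    [InnerProductSpace 𝕜 H] [CompleteSpace H] (u : ℕ → H) {K : ℝ} (hu : ∀ n, ‖u n‖ ≤ K) :
    ∃ 𝒰 : Ultrafilter ℕ, (𝒰 : Filter ℕ) ≤ atTop ∧ ∃ φ : H, ∀ g : H,
      Tendsto (fun n => inner 𝕜 (u n) g) 𝒰 (𝓝 (inner 𝕜 φ g)) := by
  let v : ℕ → WeakDual 𝕜 H := fun n =>
    StrongDual.toWeakDual (InnerProductSpace.toDual 𝕜 H (u n))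
  have hv : ∀ n, v n ∈ WeakDual.toStrongDual ⁻¹' closedBall (0 : StrongDual 𝕜 H) K := fun n => by
    rw [mem_preimage, mem_closedBall_zero_iff]
    exact ((InnerProductSpace.toDual 𝕜 H).norm_map (u n)).trans_le (hu n)
  obtain ⟨x, -, hx⟩ := (WeakDual.isCompact_closedBall (𝕜 := 𝕜) (E := H) 0 K).ultrafilter_le_nhds
    ((Ultrafilter.of atTop).map v) (by
      rw [Ultrafilter.coe_map]
      exact tendsto_principal.2 (Eventually.of_forall hv))
  refine ⟨Ultrafilter.of atTop, Ultrafilter.of_le atTop,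
    (InnerProductSpace.toDual 𝕜 H).symm (WeakDual.toStrongDual x), fun g => ?_⟩
  rw [InnerProductSpace.toDual_symm_apply]
  have h1 : Tendsto (fun y : WeakDual 𝕜 H => y g) (𝓝 x) (𝓝 (x g)) :=
    (WeakDual.eval_continuous (𝕜 := 𝕜) g).tendsto x
  have h2 : Tendsto v ((Ultrafilter.of atTop : Ultrafilter ℕ) : Filter ℕ) (𝓝 x) := hx
  refine (h1.comp h2).congr fun n => ?_
  exact InnerProductSpace.toDual_apply_apply

/-- Bounded sequences in `L²` converge weakly along an ultrafilter. -/
theorem exists_weak_limit {𝕜 X : Type*} [RCLike 𝕜] [MeasurableSpace X] {ν : Measure X}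
    (u : ℕ → X → 𝕜) (hu : ∀ n, MemLp (u n) 2 ν) {K : ℝ≥0}
    (hK : ∀ n, eLpNorm (u n) 2 ν ≤ K) :
    ∃ 𝒰 : Ultrafilter ℕ, (𝒰 : Filter ℕ) ≤ atTop ∧ ∃ φ : X → 𝕜, StronglyMeasurable φ ∧
      MemLp φ 2 ν ∧ ∀ g : X → ℝ, MemLp g 2 ν →
        Tendsto (fun n => ∫ x, g x • u n x ∂ν) 𝒰 (𝓝 (∫ x, g x • φ x ∂ν)) := by
  obtain ⟨𝒰, h𝒰, φ, hφ⟩ := exists_ultrafilter_tendsto_inner (𝕜 := 𝕜)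
    (fun n => (hu n).toLp (u n)) (K := K) (fun n => by
      rw [Lp.norm_toLp]
      exact ENNReal.toReal_le_coe_of_le_coe (hK n))
  refine ⟨𝒰, h𝒰, φ, Lp.stronglyMeasurable φ, Lp.memLp φ, fun g hg => ?_⟩
  have hg' : MemLp (fun x => (g x : 𝕜)) 2 ν := hg.ofReal
  have key : ∀ F : Lp 𝕜 2 ν, ∫ x, g x • F x ∂ν =
      (starRingEnd 𝕜) (inner 𝕜 F (hg'.toLp _)) := by
    intro F
    rw [inner_conj_symm, L2.inner_def]
    apply integral_congr_ae
    filter_upwards [hg'.coeFn_toLp] with x hx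
    rw [hx, RCLike.inner_apply, RCLike.conj_ofReal, RCLike.real_smul_eq_coe_mul, mul_comm]
  rw [key φ]
  have : ∀ n, ∫ x, g x • u n x ∂ν = (starRingEnd 𝕜) (inner 𝕜 ((hu n).toLp (u n)) (hg'.toLp _)) := by
    intro n
    rw [← key]
    apply integral_congr_ae
    filter_upwards [(hu n).coeFn_toLp] with x hx
    rw [hx]
  simp_rw [this]
  exact (RCLike.continuous_conj.tendsto _).comp (hφ _)

/-- A sequence of radii in `(0, 1)` tending to `1`. -/
noncomputable def radSeq (n : ℕ) : ℝ := 1 - 1 / ((n : ℝ) + 2)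

theorem radSeq_pos (n : ℕ) : 0 < radSeq n := by
  have : 1 / ((n : ℝ) + 2) < 1 := by
    rw [div_lt_one (by positivity)]
    have := Nat.cast_nonneg (α := ℝ) n
    linarith
  unfold radSeq
  linarith

theorem radSeq_lt_one (n : ℕ) : radSeq n < 1 := by
  have : 0 < 1 / ((n : ℝ) + 2) := by positivity
  unfold radSeq
  linarith

theorem tendsto_radSeq : Tendsto radSeq atTop (𝓝 1) := by
  have h : Tendsto (fun n : ℕ => 1 / ((n : ℝ) + 2)) atTop (𝓝 0) := by
    have := (tendsto_const_div_atTop_nhds_zero_nat (1 : ℝ)).comp (tendsto_add_atTop_nat 2)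
    refine this.congr fun n => ?_
    simp
  have := h.const_sub 1
  rwa [sub_zero] at this

theorem norm_ofReal_mul_circle {r : ℝ} (hr : 0 < r) (ξ : Circle) : ‖(r : ℂ) * ξ‖ = r := by
  rw [norm_mul, Circle.norm_coe, mul_one, Complex.norm_real, Real.norm_of_nonneg hr.le]

theorem continuous_comp_mul_circle {f : ℂ → ℂ} (hf : ContinuousOn f (ball 0 1)) {r : ℝ}
    (hr : 0 < r) (hr1 : r < 1) : Continuous fun ξ : Circle => f (r * ξ) := by
  refine hf.comp_continuous (by fun_prop) fun ξ => ?_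
  rw [mem_ball_zero_iff, norm_ofReal_mul_circle hr]
  exact hr1

theorem differentiableOn_comp_mul {f : ℂ → ℂ} (hf : DifferentiableOn ℂ f (ball 0 1)) {r : ℝ}
    (hr : 0 < r) : DifferentiableOn ℂ (fun z => f (r * z)) (ball 0 r⁻¹) := by
  refine hf.comp (by fun_prop) fun z hz => ?_
  rw [mem_ball_zero_iff] at hz ⊢
  rw [norm_mul, Complex.norm_real, Real.norm_of_nonneg hr.le]
  calc r * ‖z‖ < r * r⁻¹ := by gcongr
    _ = 1 := mul_inv_cancel₀ hr.ne'

theorem tendsto_comp_radSeq_mul {f : ℂ → ℂ} (hf : ContinuousOn f (ball 0 1)) {z : ℂ}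
    (hz : ‖z‖ < 1) : Tendsto (fun n => f (radSeq n * z)) atTop (𝓝 (f z)) := by
  have h1 : ContinuousAt f z := hf.continuousAt (isOpen_ball.mem_nhds (by simpa using hz))
  have h2 : Tendsto (fun n => (radSeq n : ℂ) * z) atTop (𝓝 z) := by
    have := (Complex.continuous_ofReal.tendsto 1).comp tendsto_radSeq
    simpa using this.mul_const z
  exact h1.tendsto.comp h2

/-- The geometric hypothesis of `lintegral_poisson_mul_le` holds in an approach region. -/
theorem dist_le_three_mul {z : ℂ} {ξ : Circle} (h : ‖(ξ : ℂ) - z‖ ≤ 2 * (1 - ‖z‖)) (ζ : Circle) :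
    dist ζ ξ ≤ 3 * ‖(ζ : ℂ) - z‖ := by
  have h1 := one_sub_norm_le z ζ
  have h2 := norm_sub_le_norm_sub_add_norm_sub (ζ : ℂ) z ξ
  rw [norm_sub_rev z] at h2
  rw [circle_dist_eq]
  linarith

theorem norm_sub_ofReal_mul {r : ℝ} (hr1 : r < 1) (ξ : Circle) :
    ‖(ξ : ℂ) - r * ξ‖ = 1 - r := by
  have : (ξ : ℂ) - r * ξ = ((1 - r : ℝ) : ℂ) * ξ := by push_cast; ring
  rw [this, norm_ofReal_mul_circle (by linarith)]

/-- If `f ∈ H¹` then `|f|^(1/2)` has a harmonic majorant that is the Poisson integral of a function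
in `L²`. -/
theorem MemH1.exists_enorm_rpow_le {f : ℂ → ℂ} (hf : MemH1 f) :
    ∃ φ : Circle → ℝ, Measurable φ ∧ MemLp φ 2 normArcLength ∧ ∀ z, ‖z‖ < 1 →
      ‖f z‖ₑ ^ (1 / 2 : ℝ) ≤ ∫⁻ ξ, ENNReal.ofReal (poisson z ξ) * ‖φ ξ‖ₑ ∂normArcLength := by
  obtain ⟨hd, hN⟩ := hf
  set N := ⨆ r ∈ Ioo (0 : ℝ) 1, ∫⁻ ξ : Circle, ‖f (r * ξ)‖ₑ ∂normArcLength with hNdef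
  have hle : ∀ n, ∫⁻ ξ : Circle, ‖f (radSeq n * ξ)‖ₑ ∂normArcLength ≤ N := fun n =>
    le_iSup₂ (f := fun r (_ : r ∈ Ioo (0 : ℝ) 1) =>
      ∫⁻ ξ : Circle, ‖f (r * ξ)‖ₑ ∂normArcLength) (radSeq n) ⟨radSeq_pos n, radSeq_lt_one n⟩
  let u : ℕ → Circle → ℝ := fun n ξ => ‖f (radSeq n * ξ)‖ ^ (1 / 2 : ℝ)
  have huc : ∀ n, Continuous (u n) := fun n =>
    (continuous_comp_mul_circle hd.continuousOn (radSeq_pos n) (radSeq_lt_one n)).norm.rpow_const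
      fun _ => Or.inr (by norm_num)
  have hue : ∀ n ξ, ‖u n ξ‖ₑ = ‖f (radSeq n * ξ)‖ₑ ^ (1 / 2 : ℝ) := fun n ξ => by
    rw [Real.enorm_of_nonneg (by positivity), enorm_rpow_eq_ofReal _ (by norm_num)]
  have hnorm : ∀ n, eLpNorm (u n) 2 normArcLength ≤ (N ^ (1 / 2 : ℝ)).toNNReal := by
    intro n
    rw [ENNReal.coe_toNNReal (ENNReal.rpow_ne_top_of_nonneg (by norm_num) hN.ne),
      eLpNorm_eq_lintegral_rpow_enorm_toReal two_ne_zero ENNReal.ofNat_ne_top]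
    simp only [ENNReal.toReal_ofNat, hue]
    gcongr
    refine le_trans (lintegral_mono fun ξ => ?_) (hle n)
    rw [← ENNReal.rpow_mul]
    norm_num
  obtain ⟨𝒰, h𝒰, φ, hφm, hφ, hlim⟩ := exists_weak_limit u (ν := normArcLength)
    (fun n => ⟨(huc n).aestronglyMeasurable, (hnorm n).trans_lt ENNReal.coe_lt_top⟩) hnorm
  refine ⟨φ, hφm.measurable, hφ, fun z hz => ?_⟩
  have hpk : MemLp (poisson z) 2 normArcLength :=
    MemLp.of_bound (continuous_poisson hz).aestronglyMeasurable (2 / (1 - ‖z‖)) (ae_of_all _ fun ξ => by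
      rw [Real.norm_of_nonneg (poisson_nonneg hz ξ)]; exact poisson_le_const hz ξ)
  have h1 : ∀ n, ‖f (radSeq n * z)‖ ^ (1 / 2 : ℝ) ≤ ∫ ξ, poisson z ξ • u n ξ ∂normArcLength := by
    intro n
    have h2 := enorm_rpow_le_lintegral_poisson (R := (radSeq n)⁻¹)
      ((one_lt_inv₀ (radSeq_pos n)).2 (radSeq_lt_one n))
      (differentiableOn_comp_mul hd (radSeq_pos n)) (s := 1 / 2) (by norm_num) hz
    have hnn : ∀ ξ, 0 ≤ poisson z ξ • u n ξ := fun ξ =>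
      mul_nonneg (poisson_nonneg hz ξ) (by positivity)
    have hi : Integrable (fun ξ => poisson z ξ • u n ξ) normArcLength :=
      ((continuous_poisson hz).smul (huc n)).integrable_of_hasCompactSupport
        (HasCompactSupport.of_compactSpace _)
    rw [← ENNReal.ofReal_le_ofReal_iff (integral_nonneg hnn),
      ofReal_integral_eq_lintegral_ofReal hi (ae_of_all _ hnn), ← enorm_rpow_eq_ofReal _ (by norm_num)]
    refine h2.trans_eq ?_
    congr with ξ
    rw [← hue, smul_eq_mul, ENNReal.ofReal_mul (poisson_nonneg hz ξ),
      Real.enorm_of_nonneg (show 0 ≤ u n ξ by positivity)]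
  have h3 : ‖f z‖ ^ (1 / 2 : ℝ) ≤ ∫ ξ, poisson z ξ • φ ξ ∂normArcLength := by
    refine le_of_tendsto_of_tendsto' (b := (𝒰 : Filter ℕ)) ?_ (hlim _ hpk) h1
    exact (((tendsto_comp_radSeq_mul hd.continuousOn hz).norm).rpow_const
      (Or.inr (by norm_num))).mono_left h𝒰
  calc ‖f z‖ₑ ^ (1 / 2 : ℝ) ≤ ENNReal.ofReal (∫ ξ, poisson z ξ • φ ξ ∂normArcLength) := by
        rw [enorm_rpow_eq_ofReal _ (by norm_num)]
        exact ENNReal.ofReal_le_ofReal h3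
    _ ≤ ‖∫ ξ, poisson z ξ • φ ξ ∂normArcLength‖ₑ := Real.ofReal_le_enorm _
    _ ≤ ∫⁻ ξ, ‖poisson z ξ • φ ξ‖ₑ ∂normArcLength := enorm_integral_le_lintegral_enorm _
    _ = _ := by
        congr with ξ
        rw [enorm_smul, Real.enorm_of_nonneg (poisson_nonneg hz ξ)]

/-- The radial maximal function of a function in `H¹` is integrable. -/
theorem MemH1.lintegral_iSup_lt_top {f : ℂ → ℂ} (hf : MemH1 f) :
    ∫⁻ ξ : Circle, ⨆ n, ‖f (radSeq n * ξ)‖ₑ ∂normArcLength < ∞ := by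
  obtain ⟨φ, hφm, hφ, hle⟩ := hf.exists_enorm_rpow_le
  have hcont : ∀ n, Continuous fun ξ : Circle => f (radSeq n * ξ) := fun n =>
    continuous_comp_mul_circle hf.1.continuousOn (radSeq_pos n) (radSeq_lt_one n)
  let h : ℕ → Circle → ℝ := fun N ξ => (Finset.range (N + 1)).sup' ⟨0, by simp⟩
    fun n => ‖f (radSeq n * ξ)‖ ^ (1 / 2 : ℝ)
  have hh : ∀ (N n : ℕ) (ξ : Circle), n ≤ N → ‖f (radSeq n * ξ)‖ ^ (1 / 2 : ℝ) ≤ h N ξ := fun N n ξ hn =>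
    Finset.le_sup' (fun n => ‖f (radSeq n * ξ)‖ ^ (1 / 2 : ℝ)) (Finset.mem_range.2 (by omega))
  have hhc : ∀ N, Continuous (h N) := fun N =>
    Continuous.finset_sup'_apply _ fun n _ =>
      (hcont n).norm.rpow_const fun _ => Or.inr (by norm_num)
  have h0 : ∀ (N : ℕ) (ξ : Circle), 0 ≤ h N ξ := fun N ξ => le_trans (by positivity) (hh N 0 ξ (Nat.zero_le N))
  have hmono : Monotone fun N ξ => ENNReal.ofReal (h N ξ ^ (2 * 1 : ℝ)) := by
    intro N M hNM ξ
    refine ENNReal.ofReal_le_ofReal (Real.rpow_le_rpow (h0 N ξ) ?_ (by norm_num))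
    exact Finset.sup'_mono _ (Finset.range_mono (by omega)) _
  set K : ℝ≥0∞ := ENNReal.ofReal ((2 * 144) ^ (2 * 1 : ℝ) * (2 * 1)) * 3 ^ (1 : ℝ) *
        (∫⁻ ζ, ‖φ ζ‖ₑ ^ 2 * 1 ∂normArcLength) ^ (1 : ℝ) with hK
  have hbound : ∀ N, ∫⁻ ξ, ENNReal.ofReal (h N ξ ^ (2 * 1 : ℝ)) ∂normArcLength ≤ K := by
    intro N
    refine lintegral_rpow_le_of_forall_setLIntegral_le (ν := normArcLength) (η := id)
      (δ := fun _ => 0) (w := fun _ => 1) (t := 1) (A := 3) le_rfl ?_ measurable_const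
      (g := fun ξ => ‖φ ξ‖ₑ) hφm.enorm (h := h N) (hhc N).measurable.aemeasurable (h0 N)
      (c := 144) (by norm_num) ?_
    · intro ξ ρ hρ
      refine ae_of_all _ fun ζ => ?_
      rw [ENNReal.rpow_one, mul_one]
      calc _ ≤ normArcLength (closedBall ξ (3 * ρ)) := measure_mono fun x hx => hx.1
        _ ≤ _ := normArcLength_closedBall_le _ _
        _ = _ := by rw [ENNReal.ofReal_mul (by norm_num), ENNReal.ofReal_ofNat]
    · intro ξ l hl hball
      refine Finset.sup'_le _ _ fun n _ => ?_
      have hr0 := radSeq_pos n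
      have hr1 := radSeq_lt_one n
      have hnz := norm_ofReal_mul_circle hr0 ξ
      have hz : ‖(radSeq n : ℂ) * ξ‖ < 1 := by rw [hnz]; exact hr1
      have := (hle _ hz).trans (lintegral_poisson_mul_le hz (ξ := ξ)
        (dist_le_three_mul (by rw [norm_sub_ofReal_mul hr1, hnz]; linarith))
        hφm.enorm.aemeasurable (M := ENNReal.ofReal l) fun ρ hρ hρ2 =>
          hball ρ (by linarith) hρ2 (by linarith))
      rwa [enorm_rpow_eq_ofReal _ (by norm_num),
        show (144 : ℝ≥0∞) = ENNReal.ofReal 144 by simp, ← ENNReal.ofReal_mul (by norm_num),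
        ENNReal.ofReal_le_ofReal_iff (by positivity)] at this
  have hKtop : K < ∞ := by
    rw [hK, ENNReal.rpow_one, ENNReal.rpow_one]
    refine ENNReal.mul_lt_top (ENNReal.mul_lt_top ENNReal.ofReal_lt_top (by simp)) ?_
    have := hφ.2
    rw [eLpNorm_lt_top_iff_lintegral_rpow_enorm_lt_top two_ne_zero ENNReal.ofNat_ne_top] at this
    simpa using this
  refine lt_of_le_of_lt ?_ hKtop
  calc _ ≤ ∫⁻ ξ : Circle, ⨆ N, ENNReal.ofReal (h N ξ ^ (2 * 1 : ℝ)) ∂normArcLength := by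
        refine lintegral_mono fun ξ => iSup_mono fun n => ?_
        rw [← ofReal_norm]
        apply ENNReal.ofReal_le_ofReal
        calc ‖f (radSeq n * ξ)‖ = (‖f (radSeq n * ξ)‖ ^ (1 / 2 : ℝ)) ^ (2 * 1 : ℝ) := by
              rw [← Real.rpow_mul (norm_nonneg _)]; norm_num
          _ ≤ _ := Real.rpow_le_rpow (by positivity) (hh n n ξ le_rfl) (by norm_num)
    _ = ⨆ N, ∫⁻ ξ : Circle, ENNReal.ofReal (h N ξ ^ (2 * 1 : ℝ)) ∂normArcLength :=
        lintegral_iSup (fun N => (((hhc N).rpow_const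
          fun _ => Or.inr (by norm_num)).measurable).ennreal_ofReal) hmono
    _ ≤ K := iSup_le hbound

/-- A function in `H¹` is the Poisson integral of an integrable function. -/
theorem MemH1.exists_eq_integral_poisson {f : ℂ → ℂ} (hf : MemH1 f) :
    ∃ ψ : Circle → ℂ, StronglyMeasurable ψ ∧ Integrable ψ normArcLength ∧
      ∀ z, ‖z‖ < 1 → f z = ∫ ξ, poisson z ξ • ψ ξ ∂normArcLength := by
  set F : Circle → ℝ≥0∞ := fun ξ => ⨆ n, ‖f (radSeq n * ξ)‖ₑ with hF
  have hcont : ∀ n, Continuous fun ξ : Circle => f (radSeq n * ξ) := fun n =>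
    continuous_comp_mul_circle hf.1.continuousOn (radSeq_pos n) (radSeq_lt_one n)
  have hFm : Measurable F := Measurable.iSup fun n => (hcont n).enorm.measurable
  have hWm : Measurable fun ξ => 1 + F ξ := measurable_const.add hFm
  have hWi : ∫⁻ ξ, 1 + F ξ ∂normArcLength ≠ ∞ := by
    rw [lintegral_add_left measurable_const]
    exact ENNReal.add_ne_top.2 ⟨by simp, hf.lintegral_iSup_lt_top.ne⟩
  have hWae : ∀ᵐ ξ ∂normArcLength, 1 + F ξ < ∞ := ae_lt_top hWm hWi
  let ν := normArcLength.withDensity fun ξ => 1 + F ξ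
  have : IsFiniteMeasure ν := isFiniteMeasure_withDensity hWi
  -- Dividing by `1 + F` makes the dilates bounded by `1`, so that weak compactness in `L²` applies.
  let u : ℕ → Circle → ℂ := fun n ξ => ((1 + F ξ).toReal)⁻¹ • f (radSeq n * ξ)
  have hum : ∀ n, Measurable (u n) := fun n =>
    (hWm.ennreal_toReal.inv).smul (hcont n).measurable
  have hub : ∀ n ξ, ‖u n ξ‖ ≤ 1 := by
    intro n ξ
    simp only [u]
    rw [norm_smul, norm_inv, Real.norm_of_nonneg ENNReal.toReal_nonneg]
    rcases eq_or_ne (1 + F ξ) ∞ with h | h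
    · simp [h]
    · have h1 : 0 < (1 + F ξ).toReal := ENNReal.toReal_pos (by simp) h
      rw [inv_mul_le_iff₀ h1, mul_one, ← ENNReal.ofReal_le_iff_le_toReal h, ofReal_norm]
      exact (le_iSup (fun n => ‖f (radSeq n * ξ)‖ₑ) n).trans le_add_self
  obtain ⟨𝒰, h𝒰, φ, hφm, hφ, hlim⟩ := exists_weak_limit u (ν := ν)
    (K := ((ν univ) ^ (2 : ℝ)⁻¹).toNNReal)
    (fun n => MemLp.of_bound (hum n).aestronglyMeasurable 1 (ae_of_all _ (hub n))) (fun n => by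
      rw [ENNReal.coe_toNNReal (ENNReal.rpow_ne_top_of_nonneg (by norm_num) (measure_ne_top _ _))]
      simpa using eLpNorm_le_of_ae_bound (p := 2) (ae_of_all ν (hub n)))
  refine ⟨fun ξ => (1 + F ξ).toReal • φ ξ, hWm.ennreal_toReal.stronglyMeasurable.smul hφm, ?_, ?_⟩
  · rw [← integrable_withDensity_iff_integrable_smul' hWm hWae]
    exact hφ.integrable one_le_two
  · intro z hz
    have hpk : MemLp (poisson z) 2 ν :=
      MemLp.of_bound (continuous_poisson hz).aestronglyMeasurable (2 / (1 - ‖z‖))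
        (ae_of_all _ fun ξ => by
          rw [Real.norm_of_nonneg (poisson_nonneg hz ξ)]; exact poisson_le_const hz ξ)
    have h1 := hlim _ hpk
    have h2 : ∀ n, ∫ ξ, poisson z ξ • u n ξ ∂ν = f (radSeq n * z) := by
      intro n
      have hR : 1 < (radSeq n)⁻¹ := (one_lt_inv₀ (radSeq_pos n)).2 (radSeq_lt_one n)
      have hdc : DiffContOnCl ℂ (fun z => f (radSeq n * z)) (ball 0 1) := by
        apply DifferentiableOn.diffContOnCl
        rw [closure_ball _ one_ne_zero]
        exact (differentiableOn_comp_mul hf.1 (radSeq_pos n)).mono (closedBall_subset_ball hR)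
      rw [integral_withDensity_eq_integral_toReal_smul hWm hWae, ← integral_poisson_smul hdc hz]
      apply integral_congr_ae
      filter_upwards [hWae] with ξ hξ
      have h3 : (1 + F ξ).toReal ≠ 0 := (ENNReal.toReal_pos (by simp) hξ.ne).ne'
      simp only [u]
      rw [smul_comm, smul_inv_smul₀ h3]
    simp_rw [h2] at h1
    rw [integral_withDensity_eq_integral_toReal_smul hWm hWae] at h1
    rw [tendsto_nhds_unique ((tendsto_comp_radSeq_mul hf.1.continuousOn hz).mono_left h𝒰) h1]
    congr with ξ
    rw [smul_comm]

/-! ### Boundary values of `H¹` functions -/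

theorem ofReal_mul_mem_approachRegion {r : ℝ} (hr : 0 < r) (hr1 : r < 1) (ξ : Circle) :
    (r : ℂ) * ξ ∈ approachRegion ξ := by
  refine ⟨by rwa [norm_ofReal_mul_circle hr], ?_⟩
  rw [norm_sub_ofReal_mul hr1, norm_ofReal_mul_circle hr]
  linarith

theorem tendsto_radSeq_mul_nhdsWithin (ξ : Circle) :
    Tendsto (fun n => (radSeq n : ℂ) * ξ) atTop (𝓝[approachRegion ξ] (ξ : ℂ)) := by
  refine tendsto_nhdsWithin_iff.2 ⟨?_, Eventually.of_forall fun n =>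
    ofReal_mul_mem_approachRegion (radSeq_pos n) (radSeq_lt_one n) ξ⟩
  have := (Complex.continuous_ofReal.tendsto 1).comp tendsto_radSeq
  simpa using this.mul_const (ξ : ℂ)

instance (ξ : Circle) : (𝓝[approachRegion ξ] (ξ : ℂ)).NeBot :=
  (tendsto_radSeq_mul_nhdsWithin ξ).neBot

/-- **Fatou's theorem**: the Poisson integral of an integrable function `ψ` converges
non-tangentially to `ψ` at every Lebesgue point of `ψ`. -/
theorem ae_tendsto_integral_poisson {ψ : Circle → ℂ} (hψm : StronglyMeasurable ψ)
    (hψ : Integrable ψ normArcLength) :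
    ∀ᵐ ξ : Circle ∂normArcLength, Tendsto (fun z => ∫ ζ, poisson z ζ • ψ ζ ∂normArcLength)
      (𝓝[approachRegion ξ] (ξ : ℂ)) (𝓝 (ψ ξ)) := by
  filter_upwards [IsUnifLocDoublingMeasure.ae_tendsto_average_norm_sub normArcLength
    hψ.locallyIntegrable 1] with ξ hξ
  have hleb := hξ (l := 𝓝[>] (0 : ℝ)) (fun _ => ξ) id tendsto_id (by
    filter_upwards [self_mem_nhdsWithin] with ρ hρ
    exact mem_closedBall_self (by simpa using (mem_Ioi.1 hρ).le))
  simp only [id] at hleb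
  let g : Circle → ℝ≥0∞ := fun ζ => ‖ψ ζ - ψ ξ‖ₑ
  have hgm : Measurable g := (hψm.measurable.sub_const _).enorm
  have hgi : ∫⁻ ζ, g ζ ∂normArcLength < ∞ := (hψ.sub (integrable_const (ψ ξ))).2
  -- Convert the Lebesgue point condition to a bound for the integral of `g` over small balls.
  have hsmall : ∀ ε : ℝ, 0 < ε → ∃ ρ₀ > 0, ∀ ρ, 0 < ρ → ρ ≤ ρ₀ →
      ∫⁻ ζ in closedBall ξ ρ, g ζ ∂normArcLength ≤ ENNReal.ofReal ε * ENNReal.ofReal ρ := by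
    intro ε hε
    have h1 := (hleb.eventually (gt_mem_nhds hε))
    rw [eventually_nhdsWithin_iff, Metric.eventually_nhds_iff] at h1
    obtain ⟨r, hr, hr'⟩ := h1
    refine ⟨r / 2, by positivity, fun ρ hρ hρr => ?_⟩
    have h2 := hr' (y := ρ) (by rw [Real.dist_0_eq_abs, abs_of_pos hρ]; linarith) hρ
    have h3 := measure_smul_setAverage (μ := normArcLength) (fun ζ => ‖ψ ζ - ψ ξ‖)
      (measure_ne_top normArcLength (closedBall ξ ρ))
    have hint : Integrable (fun ζ => ‖ψ ζ - ψ ξ‖) (normArcLength.restrict (closedBall ξ ρ)) :=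
      ((hψ.sub (integrable_const (ψ ξ))).norm).restrict
    calc ∫⁻ ζ in closedBall ξ ρ, g ζ ∂normArcLength
        = ENNReal.ofReal (∫ ζ in closedBall ξ ρ, ‖ψ ζ - ψ ξ‖ ∂normArcLength) := by
          rw [ofReal_integral_eq_lintegral_ofReal hint (ae_of_all _ fun _ => norm_nonneg _)]
          simp only [ofReal_norm, g]
      _ ≤ ENNReal.ofReal (normArcLength.real (closedBall ξ ρ) * ε) := by
          apply ENNReal.ofReal_le_ofReal
          rw [← h3, smul_eq_mul]
          exact mul_le_mul_of_nonneg_left h2.le measureReal_nonneg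
      _ ≤ _ := by
          rw [mul_comm, ENNReal.ofReal_mul hε.le]
          gcongr
          exact ENNReal.toReal_le_of_le_ofReal hρ.le (normArcLength_closedBall_le ξ ρ)
  rw [Metric.tendsto_nhds]
  intro ε hε
  obtain ⟨ρ₀, hρ₀, hball⟩ := hsmall (ε / 300) (by positivity)
  -- Far from `ξ` the Poisson kernel tends to zero uniformly as `z` approaches `ξ`.
  have hfar : Tendsto (fun z : ℂ => ENNReal.ofReal (18 * (1 - ‖z‖) / ρ₀ ^ 2) *
      ∫⁻ ζ, g ζ ∂normArcLength) (𝓝[approachRegion ξ] (ξ : ℂ)) (𝓝 0) := by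
    have h1 : Continuous fun z : ℂ => ENNReal.ofReal (18 * (1 - ‖z‖) / ρ₀ ^ 2) :=
      ENNReal.continuous_ofReal.comp (by fun_prop)
    have h2 := ENNReal.Tendsto.mul_const (h1.tendsto (ξ : ℂ)) (Or.inr hgi.ne)
    rw [Circle.norm_coe, sub_self, mul_zero, zero_div, ENNReal.ofReal_zero, zero_mul] at h2
    exact h2.mono_left nhdsWithin_le_nhds
  filter_upwards [self_mem_nhdsWithin, hfar.eventually
    (gt_mem_nhds (show (0 : ℝ≥0∞) < ENNReal.ofReal (ε / 3) by simpa using hε))] with z hz hzfar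
  obtain ⟨hz1, hz2⟩ := hz
  have hd := dist_le_three_mul hz2.le
  have hpki : Integrable (poisson z) normArcLength :=
    (continuous_poisson hz1).integrable_of_hasCompactSupport (HasCompactSupport.of_compactSpace _)
  have hnear : ∫⁻ ζ, ENNReal.ofReal (poisson z ζ) * (closedBall ξ ρ₀).indicator g ζ ∂normArcLength ≤
      144 * ENNReal.ofReal (ε / 300) := by
    refine lintegral_poisson_mul_le hz1 hd (hgm.indicator isClosed_closedBall.measurableSet).aemeasurable
      fun ρ hρ _ => ?_
    have hρ0 : 0 < ρ := by linarith
    rcases le_total ρ ρ₀ with h | h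
    · exact (lintegral_mono fun ζ => indicator_le_self _ _ _).trans (hball ρ hρ0 h)
    · calc _ ≤ ∫⁻ ζ, (closedBall ξ ρ₀).indicator g ζ ∂normArcLength :=
            lintegral_mono' Measure.restrict_le_self le_rfl
        _ = ∫⁻ ζ in closedBall ξ ρ₀, g ζ ∂normArcLength :=
            lintegral_indicator isClosed_closedBall.measurableSet _
        _ ≤ _ := hball ρ₀ hρ₀ le_rfl
        _ ≤ _ := by gcongr
  have hsplit : ∫⁻ ζ, ENNReal.ofReal (poisson z ζ) * g ζ ∂normArcLength ≤
      ENNReal.ofReal (144 * (ε / 300) + ε / 3) := by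
    calc _ ≤ ∫⁻ ζ, (ENNReal.ofReal (poisson z ζ) * (closedBall ξ ρ₀).indicator g ζ +
          ENNReal.ofReal (18 * (1 - ‖z‖) / ρ₀ ^ 2) * g ζ) ∂normArcLength := by
          refine lintegral_mono fun ζ => ?_
          by_cases hζ : ζ ∈ closedBall ξ ρ₀
          · rw [indicator_of_mem hζ]; exact le_self_add
          · refine le_trans ?_ le_add_self
            gcongr
            rw [mem_closedBall, not_le] at hζ
            have h3 : ρ₀ / 3 ≤ ‖(ζ : ℂ) - z‖ := by linarith [hd ζ]
            calc poisson z ζ ≤ 2 * (1 - ‖z‖) / ‖(ζ : ℂ) - z‖ ^ 2 := poisson_le hz1 ζ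
              _ ≤ 2 * (1 - ‖z‖) / (ρ₀ / 3) ^ 2 := by
                  have : 0 ≤ 1 - ‖z‖ := by linarith
                  gcongr
              _ = _ := by field_simp; ring
      _ = ∫⁻ ζ, ENNReal.ofReal (poisson z ζ) * (closedBall ξ ρ₀).indicator g ζ ∂normArcLength +
          ENNReal.ofReal (18 * (1 - ‖z‖) / ρ₀ ^ 2) * ∫⁻ ζ, g ζ ∂normArcLength := by
          rw [lintegral_add_right _ (hgm.const_mul _), lintegral_const_mul _ hgm]
      _ ≤ 144 * ENNReal.ofReal (ε / 300) + ENNReal.ofReal (ε / 3) := add_le_add hnear hzfar.le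
      _ = _ := by
          rw [ENNReal.ofReal_add (by positivity) (by positivity), ENNReal.ofReal_mul (by norm_num)]
          simp
  have hpψ : Integrable (fun ζ => poisson z ζ • ψ ζ) normArcLength :=
    hψ.bdd_smul _ (continuous_poisson hz1).aestronglyMeasurable
      (ae_of_all _ fun ζ => by
        rw [Real.norm_of_nonneg (poisson_nonneg hz1 ζ)]; exact poisson_le_const hz1 ζ)
  have hdiff : (∫ ζ, poisson z ζ • ψ ζ ∂normArcLength) - ψ ξ =
      ∫ ζ, poisson z ζ • (ψ ζ - ψ ξ) ∂normArcLength := by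
    simp_rw [smul_sub]
    rw [integral_sub hpψ (hpki.smul_const _)]
    congr 1
    exact (integral_poisson_smul (f := fun _ => ψ ξ) diffContOnCl_const hz1).symm
  rw [dist_eq_norm, hdiff]
  have hfin : ‖∫ ζ, poisson z ζ • (ψ ζ - ψ ξ) ∂normArcLength‖ₑ ≤
      ENNReal.ofReal (144 * (ε / 300) + ε / 3) := by
    refine (enorm_integral_le_lintegral_enorm _).trans (le_trans (le_of_eq ?_) hsplit)
    congr with ζ
    rw [enorm_smul, Real.enorm_of_nonneg (poisson_nonneg hz1 ζ)]
  rw [← ofReal_norm, ENNReal.ofReal_le_ofReal_iff (by positivity)] at hfin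
  linarith

/-- A function in `H¹` has non-tangential limits almost everywhere. -/
theorem MemH1.ae_tendsto_boundaryValue {f : ℂ → ℂ} (hf : MemH1 f) :
    ∀ᵐ ξ : Circle ∂normArcLength, Tendsto f (𝓝[approachRegion ξ] (ξ : ℂ)) (𝓝 (boundaryValue f ξ)) := by
  obtain ⟨ψ, hψm, hψ, hfψ⟩ := hf.exists_eq_integral_poisson
  filter_upwards [ae_tendsto_integral_poisson hψm hψ] with ξ hξ
  have h1 : Tendsto f (𝓝[approachRegion ξ] (ξ : ℂ)) (𝓝 (ψ ξ)) := by
    refine hξ.congr' ?_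
    filter_upwards [self_mem_nhdsWithin] with z hz
    exact (hfψ z hz.1).symm
  rw [boundaryValue, h1.limUnder_eq]
  exact h1

theorem MemH1.aemeasurable_boundaryValue {f : ℂ → ℂ} (hf : MemH1 f) :
    AEMeasurable (boundaryValue f) normArcLength := by
  refine aemeasurable_of_tendsto_metrizable_ae atTop
    (f := fun n (ξ : Circle) => f (radSeq n * ξ)) (fun n =>
      (continuous_comp_mul_circle hf.1.continuousOn (radSeq_pos n)
        (radSeq_lt_one n)).measurable.aemeasurable) ?_
  filter_upwards [hf.ae_tendsto_boundaryValue] with ξ hξ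
  exact hξ.comp (tendsto_radSeq_mul_nhdsWithin ξ)

theorem MemH1.enorm_rpow_le_of_le_one {f : ℂ → ℂ} (hf : MemH1 f) {s : ℝ} (hs : 0 < s) (hs1 : s ≤ 1)
    {z : ℂ} (hz : ‖z‖ < 1) :
    ‖f z‖ₑ ^ s ≤ ∫⁻ ξ, ENNReal.ofReal (poisson z ξ) * ‖boundaryValue f ξ‖ₑ ^ s ∂normArcLength := by
  set F : Circle → ℝ≥0∞ := fun ξ => ⨆ n, ‖f (radSeq n * ξ)‖ₑ with hF
  have hcont : ∀ n, Continuous fun ξ : Circle => f (radSeq n * ξ) := fun n =>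
    continuous_comp_mul_circle hf.1.continuousOn (radSeq_pos n) (radSeq_lt_one n)
  have hlim : Tendsto (fun n => ∫⁻ ξ : Circle, ENNReal.ofReal (poisson z ξ) *
      ‖f (radSeq n * ξ)‖ₑ ^ s ∂normArcLength) atTop
      (𝓝 (∫⁻ ξ, ENNReal.ofReal (poisson z ξ) * ‖boundaryValue f ξ‖ₑ ^ s ∂normArcLength)) := by
    refine tendsto_lintegral_of_dominated_convergence
      (fun ξ => ENNReal.ofReal (2 / (1 - ‖z‖)) * (1 + F ξ)) (fun n => ?_) (fun n => ?_) ?_ ?_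
    · exact (continuous_poisson hz).measurable.ennreal_ofReal.mul
        ((hcont n).enorm.measurable.pow_const s)
    · refine ae_of_all _ fun ξ => ?_
      beta_reduce
      gcongr
      · exact poisson_le_const hz ξ
      · have h1 : ‖f (radSeq n * ξ)‖ₑ ≤ F ξ := le_iSup (fun n => ‖f (radSeq n * ξ)‖ₑ) n
        calc ‖f (radSeq n * ξ)‖ₑ ^ s ≤ (1 + F ξ) ^ s := by
              gcongr; exact h1.trans le_add_self
          _ ≤ (1 + F ξ) ^ (1 : ℝ) := ENNReal.rpow_le_rpow_of_exponent_le le_self_add hs1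
          _ = _ := ENNReal.rpow_one _
    · rw [lintegral_const_mul' _ _ ENNReal.ofReal_ne_top, lintegral_add_left measurable_const]
      exact ENNReal.mul_ne_top ENNReal.ofReal_ne_top
        (ENNReal.add_ne_top.2 ⟨by simp, hf.lintegral_iSup_lt_top.ne⟩)
    · filter_upwards [hf.ae_tendsto_boundaryValue] with ξ hξ
      refine ENNReal.Tendsto.const_mul ?_ (Or.inr ENNReal.ofReal_ne_top)
      exact ((hξ.comp (tendsto_radSeq_mul_nhdsWithin ξ)).enorm).ennrpow_const s
  refine le_of_tendsto_of_tendsto'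
    (((tendsto_comp_radSeq_mul hf.1.continuousOn hz).enorm).ennrpow_const s) hlim fun n => ?_
  exact enorm_rpow_le_lintegral_poisson (R := (radSeq n)⁻¹)
    ((one_lt_inv₀ (radSeq_pos n)).2 (radSeq_lt_one n))
    (differentiableOn_comp_mul hf.1 (radSeq_pos n)) hs hz

/-- For `f ∈ H¹` the function `|f|^s` is dominated by the Poisson integral of its boundary
values, for every exponent `s > 0`. -/
theorem MemH1.enorm_rpow_le {f : ℂ → ℂ} (hf : MemH1 f) {s : ℝ} (hs : 0 < s)
    {z : ℂ} (hz : ‖z‖ < 1) :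
    ‖f z‖ₑ ^ s ≤ ∫⁻ ξ, ENNReal.ofReal (poisson z ξ) * ‖boundaryValue f ξ‖ₑ ^ s ∂normArcLength := by
  rcases le_total s 1 with hs1 | hs1
  · exact hf.enorm_rpow_le_of_le_one hs hs1 hz
  have hpm : Measurable fun ξ => ENNReal.ofReal (poisson z ξ) :=
    (continuous_poisson hz).measurable.ennreal_ofReal
  let P := normArcLength.withDensity fun ξ => ENNReal.ofReal (poisson z ξ)
  have hP : IsProbabilityMeasure P := ⟨by
    rw [withDensity_apply _ MeasurableSet.univ, Measure.restrict_univ, lintegral_poisson hz]⟩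
  have hbm := hf.aemeasurable_boundaryValue
  have hbP : AEStronglyMeasurable (boundaryValue f) P :=
    (hbm.mono_ac (withDensity_absolutelyContinuous _ _)).aestronglyMeasurable
  have hconv : ∀ s : ℝ, ∫⁻ ξ, ENNReal.ofReal (poisson z ξ) * ‖boundaryValue f ξ‖ₑ ^ s ∂normArcLength =
      ∫⁻ ξ, ‖boundaryValue f ξ‖ₑ ^ s ∂P := fun s =>
    (lintegral_withDensity_eq_lintegral_mul₀ hpm.aemeasurable (hbm.enorm.pow_const s)).symm
  -- For `s ≥ 1` the case of exponent `1` and Jensen's inequality for the probability measure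
  -- `P_z |dξ|` give the claim.
  have h1 := hf.enorm_rpow_le_of_le_one one_pos le_rfl hz
  rw [hconv, ENNReal.rpow_one] at h1
  have h2 := eLpNorm'_le_eLpNorm'_of_exponent_le one_pos hs1 P hbP
  rw [eLpNorm'_eq_lintegral_enorm, eLpNorm'_eq_lintegral_enorm] at h2
  simp only [ENNReal.rpow_one, ne_eq, one_ne_zero, not_false_eq_true, div_self] at h1 h2
  rw [hconv, ← ENNReal.le_rpow_inv_iff hs, ← one_div]
  exact h1.trans h2

/-! ### The embedding and the Carleson condition -/

theorem normArcLength_absolutelyContinuous : normArcLength ≪ arcLength :=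
  Measure.smul_absolutelyContinuous

theorem eLpNorm_ofReal_eq {X : Type*} [MeasurableSpace X] (ν : Measure X) (F : X → ℂ) {p : ℝ}
    (hp : 0 < p) :
    eLpNorm F (ENNReal.ofReal p) ν = (∫⁻ x, ‖F x‖ₑ ^ p ∂ν) ^ (1 / p) := by
  rw [eLpNorm_eq_lintegral_rpow_enorm_toReal (by simpa using hp) ENNReal.ofReal_ne_top,
    ENNReal.toReal_ofReal hp.le]

theorem weightedHardyNorm_eq {ω : Circle → ℝ≥0} (hω : AEMeasurable ω arcLength) {f : ℂ → ℂ}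
    (hf : AEMeasurable (boundaryValue f) normArcLength) {p : ℝ} (hp : 0 < p) :
    weightedHardyNorm p ω f =
      (∫⁻ ξ, ‖boundaryValue f ξ‖ₑ ^ p * ω ξ ∂normArcLength) ^ (1 / p) := by
  rw [weightedHardyNorm, eLpNorm_ofReal_eq _ _ hp, weightedMeasure,
    lintegral_withDensity_eq_lintegral_mul₀
      (hω.mono_ac normArcLength_absolutelyContinuous).coe_nnreal_ennreal (hf.enorm.pow_const p)]
  simp only [Pi.mul_apply, mul_comm]

theorem weightMass_eq (ω : Circle → ℝ≥0) (I : Set Circle) :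
    weightMass ω I = ENNReal.ofReal (2 * π) * ∫⁻ ξ in I, ω ξ ∂normArcLength := by
  rw [weightMass, arcLength_eq_smul, Measure.restrict_smul, lintegral_smul_measure, smul_eq_mul]

/-- The radial projection of the disk onto the circle (sending the centre to `1`). -/
noncomputable def circleDir (z : Disk) : Circle := Circle.exp (Complex.arg z)

theorem norm_mul_circleDir (z : Disk) : ((‖(z : ℂ)‖ : ℝ) : ℂ) * circleDir z = z := by
  rw [circleDir, Circle.coe_exp, Complex.norm_mul_exp_arg_mul_I]

theorem Disk.norm_lt_one (z : Disk) : ‖(z : ℂ)‖ < 1 := mem_ball_zero_iff.1 z.2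

/-- The factor `14` guarantees that the normalized length of the ball is at least `min (2ρ) 1`. -/
theorem setOf_dist_circleDir_subset_carlesonBox (ξ : Circle) {ρ : ℝ} (hρ : 0 < ρ) :
    {z : Disk | dist (circleDir z) ξ ≤ 3 * ρ ∧ 1 - ‖(z : ℂ)‖ ≤ 2 * ρ} ⊆
      carlesonBox (closedBall ξ (14 * ρ)) := by
  rintro z ⟨h1, h2⟩
  refine ⟨?_, circleDir z, h1.trans (by linarith), (norm_mul_circleDir z).symm⟩
  have h3 := (ENNReal.ofReal_le_iff_le_toReal (measure_ne_top _ _)).1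
    (le_normArcLength_closedBall ξ (ρ := 14 * ρ))
  have h4 : 1 - ‖(z : ℂ)‖ ≤ min (14 * ρ / (2 * π)) 1 := by
    refine le_min (h2.trans ?_) (by linarith [norm_nonneg (z : ℂ)])
    rw [le_div_iff₀ Real.two_pi_pos]
    nlinarith [Real.pi_lt_d2]
  linarith

/-- The Carleson condition implies the embedding. -/
theorem exists_eLpNorm_le_of_carlesonBox_le (μ : Measure Disk) {ω : Circle → ℝ≥0}
    (hω : AEMeasurable ω arcLength) (hA1 : IsA1 ω) {p q : ℝ} (hp : 0 < p) (hpq : p ≤ q)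
    {K : ℝ≥0} (hK : ∀ I, IsArc I → μ (carlesonBox I) ≤ K * weightMass ω I ^ (q / p)) :
    ∃ C : ℝ≥0, 0 < C ∧ ∀ f : ℂ → ℂ, MemWeightedHardy p ω f →
      eLpNorm (fun z : Disk => f z) (ENNReal.ofReal q) μ ≤ C * weightedHardyNorm p ω f := by
  have hq : 0 < q := hp.trans_le hpq
  set t := q / p with ht
  have ht1 : 1 ≤ t := (one_le_div hp).2 hpq
  have ht0 : 0 < t := by linarith
  obtain ⟨A, hA⟩ := hA1.exists_setLIntegral_closedBall_le
  have hω' := hω.mono_ac normArcLength_absolutelyContinuous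
  set w : Circle → ℝ≥0∞ := fun ξ => ((hω'.mk ω ξ : ℝ≥0) : ℝ≥0∞) with hw
  have hwm : Measurable w := hω'.measurable_mk.coe_nnreal_ennreal
  have hww : ∀ᵐ ξ ∂normArcLength, (ω ξ : ℝ≥0∞) = w ξ := by
    filter_upwards [hω'.ae_eq_mk] with ξ hξ
    rw [hw, hξ]
  set A' : ℝ≥0∞ := (K : ℝ≥0∞) ^ t⁻¹ * (ENNReal.ofReal (2 * π) * (A * 14)) with hA'
  have hA'top : A' ≠ ∞ := by
    refine ENNReal.mul_ne_top (ENNReal.rpow_ne_top_of_nonneg (by positivity) ENNReal.coe_ne_top)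
      (ENNReal.mul_ne_top ENNReal.ofReal_ne_top (ENNReal.mul_ne_top ENNReal.coe_ne_top (by simp)))
  have H : ∀ (ξ : Circle) (ρ : ℝ), 0 < ρ → ∀ᵐ ζ ∂normArcLength.restrict (closedBall ξ ρ),
      μ {z | dist (circleDir z) ξ ≤ 3 * ρ ∧ 1 - ‖(z : ℂ)‖ ≤ 2 * ρ} ≤
        (A' * ENNReal.ofReal ρ * w ζ) ^ t := by
    intro ξ ρ hρ
    have h1 := ae_restrict_of_ae_restrict_of_subset
      (closedBall_subset_closedBall (by linarith : ρ ≤ 14 * ρ)) (hA ξ (14 * ρ) (by linarith))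
    filter_upwards [h1, ae_restrict_of_ae hww] with ζ hζ hζw
    calc _ ≤ μ (carlesonBox (closedBall ξ (14 * ρ))) :=
          measure_mono (setOf_dist_circleDir_subset_carlesonBox ξ hρ)
      _ ≤ K * weightMass ω (closedBall ξ (14 * ρ)) ^ t :=
          hK _ (isArc_closedBall ξ (by linarith))
      _ ≤ K * (ENNReal.ofReal (2 * π) * (A * ENNReal.ofReal (14 * ρ) * w ζ)) ^ t := by
          rw [weightMass_eq, ← hζw]
          gcongr
      _ = ((K : ℝ≥0∞) ^ t⁻¹ *
            (ENNReal.ofReal (2 * π) * (A * ENNReal.ofReal (14 * ρ) * w ζ))) ^ t := by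
          rw [ENNReal.mul_rpow_of_nonneg ((K : ℝ≥0∞) ^ t⁻¹) _ ht0.le, ENNReal.rpow_inv_rpow ht0.ne']
      _ = _ := by
          rw [ENNReal.ofReal_mul (by norm_num : (0 : ℝ) ≤ 14), ENNReal.ofReal_ofNat, hA']
          congr 1
          ring
  set K₁ : ℝ≥0∞ := ENNReal.ofReal ((2 * 144) ^ (2 * t) * (2 * t)) * A' ^ t with hK₁
  have hK₁top : K₁ ≠ ∞ := ENNReal.mul_ne_top ENNReal.ofReal_ne_top
    (ENNReal.rpow_ne_top_of_nonneg ht0.le hA'top)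
  refine ⟨(K₁ ^ (1 / q)).toNNReal + 1, by positivity, fun f hf => ?_⟩
  have hH1 := hf.1
  have hbm := hH1.aemeasurable_boundaryValue
  let g : Circle → ℝ≥0∞ := fun ξ => ‖AEMeasurable.mk _ hbm ξ‖ₑ ^ (p / 2)
  have hgm : Measurable g := hbm.measurable_mk.enorm.pow_const _
  have hgae : ∀ᵐ ξ ∂normArcLength, ‖boundaryValue f ξ‖ₑ ^ (p / 2) = g ξ := by
    filter_upwards [hbm.ae_eq_mk] with ξ hξ
    rw [hξ]
  have hfc : Continuous fun z : Disk => f z :=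
    continuousOn_iff_continuous_domRestrict.1 hH1.1.continuousOn
  have main := lintegral_rpow_le_of_forall_setLIntegral_le (ν := μ) (η := circleDir)
    (δ := fun z => 1 - ‖(z : ℂ)‖) (w := w) (A := A') ht1 H hwm hgm
    (h := fun z => ‖f z‖ ^ (p / 2))
    (hfc.norm.rpow_const fun _ => Or.inr (by positivity)).measurable.aemeasurable
    (fun z => by positivity) (c := 144) (by norm_num) (by
      intro z l hl hball
      have hz := Disk.norm_lt_one z
      have hd : ‖(circleDir z : ℂ) - z‖ ≤ 2 * (1 - ‖(z : ℂ)‖) := by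
        have := norm_sub_ofReal_mul hz (circleDir z)
        rw [norm_mul_circleDir] at this
        rw [this]
        linarith
      have h1 := (hH1.enorm_rpow_le (s := p / 2) (by positivity) hz).trans
        ((lintegral_congr_ae (hgae.mono fun ξ hξ => by rw [hξ])).le.trans
          (lintegral_poisson_mul_le hz (dist_le_three_mul hd) hgm.aemeasurable (M := ENNReal.ofReal l)
            fun ρ hρ hρ2 => hball ρ (by linarith) hρ2 hρ))
      rwa [enorm_rpow_eq_ofReal _ (by positivity),
        show (144 : ℝ≥0∞) = ENNReal.ofReal 144 by simp, ← ENNReal.ofReal_mul (by norm_num),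
        ENNReal.ofReal_le_ofReal_iff (by positivity)] at h1)
  have hleft : ∀ z : Disk, ENNReal.ofReal ((‖f z‖ ^ (p / 2)) ^ (2 * t)) = ‖f z‖ₑ ^ q := by
    intro z
    rw [← Real.rpow_mul (norm_nonneg _), enorm_rpow_eq_ofReal _ hq.le]
    congr 2
    rw [ht]
    field_simp
  have hright : ∫⁻ ξ, g ξ ^ 2 * w ξ ∂normArcLength =
      ∫⁻ ξ, ‖boundaryValue f ξ‖ₑ ^ p * ω ξ ∂normArcLength := by
    apply lintegral_congr_ae
    filter_upwards [hgae, hww] with ξ h1 h2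
    rw [← h1, h2, ← ENNReal.rpow_two, ← ENNReal.rpow_mul]
    congr 2
    ring
  simp only [hleft] at main
  rw [hright] at main
  rw [eLpNorm_ofReal_eq _ _ hq, weightedHardyNorm_eq hω hbm hp]
  set Y := ∫⁻ ξ, ‖boundaryValue f ξ‖ₑ ^ p * ω ξ ∂normArcLength
  calc _ ≤ (K₁ * Y ^ t) ^ (1 / q) := by gcongr
    _ = K₁ ^ (1 / q) * Y ^ (1 / p) := by
        rw [ENNReal.mul_rpow_of_nonneg _ _ (by positivity), ← ENNReal.rpow_mul]
        congr 2
        rw [ht]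
        field_simp
    _ ≤ _ := by
        gcongr
        rw [ENNReal.coe_add, ENNReal.coe_toNNReal
          (ENNReal.rpow_ne_top_of_nonneg (by positivity) hK₁top)]
        exact le_self_add

theorem IsA1.lintegral_lt_top {ω : Circle → ℝ≥0} (hA1 : IsA1 ω) :
    ∫⁻ ξ, ω ξ ∂normArcLength < ∞ := by
  obtain ⟨A, hA⟩ := hA1.exists_setLIntegral_closedBall_le
  have h := hA 1 2 two_pos
  rw [closedBall_eq_univ le_rfl, Measure.restrict_univ] at h
  obtain ⟨ζ, hζ⟩ := h.exists
  exact hζ.trans_lt (ENNReal.mul_lt_top (ENNReal.mul_lt_top ENNReal.coe_lt_top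
    ENNReal.ofReal_lt_top) ENNReal.coe_lt_top)

/-- The test function `z ↦ (1 - ā z)^(-N)`. -/
noncomputable def testFun (a : ℂ) (N : ℕ) (z : ℂ) : ℂ := ((1 - (starRingEnd ℂ) a * z) ^ N)⁻¹

theorem one_sub_norm_le_norm_one_sub (a : ℂ) {z : ℂ} (hz : ‖z‖ ≤ 1) :
    1 - ‖a‖ ≤ ‖1 - (starRingEnd ℂ) a * z‖ := by
  have h1 := norm_sub_norm_le (1 : ℂ) ((starRingEnd ℂ) a * z)
  rw [norm_one, norm_mul, RCLike.norm_conj] at h1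
  nlinarith [norm_nonneg a]

theorem differentiableAt_testFun {a : ℂ} (ha : ‖a‖ < 1) (N : ℕ) {z : ℂ} (hz : ‖z‖ ≤ 1) :
    DifferentiableAt ℂ (testFun a N) z := by
  have h : (1 - (starRingEnd ℂ) a * z) ^ N ≠ 0 := by
    refine pow_ne_zero _ (norm_pos_iff.1 ?_)
    linarith [one_sub_norm_le_norm_one_sub a hz]
  unfold testFun
  fun_prop (disch := assumption)

theorem norm_testFun_le {a : ℂ} (ha : ‖a‖ < 1) (N : ℕ) {z : ℂ} (hz : ‖z‖ ≤ 1) :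
    ‖testFun a N z‖ ≤ ((1 - ‖a‖) ^ N)⁻¹ := by
  have h := one_sub_norm_le_norm_one_sub a hz
  have h0 : 0 < 1 - ‖a‖ := by linarith
  rw [testFun, norm_inv, norm_pow]
  gcongr

theorem boundaryValue_testFun {a : ℂ} (ha : ‖a‖ < 1) (N : ℕ) :
    boundaryValue (testFun a N) = fun ξ : Circle => testFun a N ξ := by
  funext ξ
  exact Tendsto.limUnder_eq ((differentiableAt_testFun ha N
    (Circle.norm_coe ξ).le).continuousAt.tendsto.mono_left nhdsWithin_le_nhds)

theorem continuous_testFun_circle {a : ℂ} (ha : ‖a‖ < 1) (N : ℕ) :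
    Continuous fun ξ : Circle => testFun a N ξ :=
  continuous_iff_continuousAt.2 fun ξ => ContinuousAt.comp (f := fun ξ : Circle => (ξ : ℂ))
    (differentiableAt_testFun ha N (Circle.norm_coe ξ).le).continuousAt
    continuous_coe_circle.continuousAt

theorem memH1_testFun {a : ℂ} (ha : ‖a‖ < 1) (N : ℕ) : MemH1 (testFun a N) := by
  refine ⟨fun z hz => (differentiableAt_testFun ha N
    (mem_ball_zero_iff.1 hz).le).differentiableWithinAt, ?_⟩
  refine lt_of_le_of_lt (b := ENNReal.ofReal ((1 - ‖a‖) ^ N)⁻¹) (iSup₂_le fun r hr => ?_)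
    ENNReal.ofReal_lt_top
  calc _ ≤ ∫⁻ _ : Circle, ENNReal.ofReal ((1 - ‖a‖) ^ N)⁻¹ ∂normArcLength := by
        refine lintegral_mono fun ξ => ?_
        rw [← ofReal_norm]
        refine ENNReal.ofReal_le_ofReal (norm_testFun_le ha N ?_)
        rw [norm_ofReal_mul_circle hr.1]
        exact hr.2.le
    _ = _ := by simp

theorem norm_one_sub_conj_mul_circle (a : ℂ) (ξ : Circle) :
    ‖1 - (starRingEnd ℂ) a * ξ‖ = ‖(ξ : ℂ) - a‖ := by
  refine (pow_left_inj₀ (norm_nonneg _) (norm_nonneg _) two_ne_zero).1 ?_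
  rw [norm_one_sub_conj_mul_sq, Circle.norm_coe]
  ring

/-- On the circle the `p`-th power of the test function is dominated by a Poisson kernel as soon as
`N p ≥ 2`. -/
theorem norm_testFun_rpow_le {a : ℂ} (ha : ‖a‖ < 1) {N : ℕ} {p : ℝ} (hN : 2 ≤ N * p)
    (ξ : Circle) : ‖testFun a N ξ‖ ^ p ≤ (1 - ‖a‖) ^ (1 - N * p) * poisson a ξ := by
  set d := 1 - ‖a‖ with hd
  have hd0 : 0 < d := by linarith
  have hx : d ≤ ‖(ξ : ℂ) - a‖ := one_sub_norm_le a ξ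
  set x := ‖(ξ : ℂ) - a‖ with hxdef
  have hx0 : 0 < x := hd0.trans_le hx
  have h1 : ‖testFun a N ξ‖ ^ p = x ^ (-2 : ℝ) * x ^ (2 - N * p) := by
    rw [testFun, norm_inv, norm_pow, norm_one_sub_conj_mul_circle, ← hxdef, ← Real.rpow_add hx0,
      ← Real.rpow_natCast, ← Real.rpow_neg hx0.le, ← Real.rpow_mul hx0.le]
    congr 1
    ring
  have h2 : d * x ^ (-2 : ℝ) ≤ poisson a ξ := by
    rw [poisson, Real.rpow_neg hx0.le, Real.rpow_two, ← div_eq_mul_inv]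
    gcongr
    nlinarith [norm_nonneg a]
  calc _ = x ^ (-2 : ℝ) * x ^ (2 - N * p) := h1
    _ ≤ x ^ (-2 : ℝ) * d ^ (2 - N * p) := by
        refine mul_le_mul_of_nonneg_left ?_ (by positivity)
        exact Real.rpow_le_rpow_of_nonpos hd0 hx (by linarith)
    _ = d ^ (1 - N * p) * (d * x ^ (-2 : ℝ)) := by
        rw [show (2 : ℝ) - N * p = (1 - N * p) + 1 by ring, Real.rpow_add_one hd0.ne']
        ring
    _ ≤ _ := by gcongr

/-- The embedding implies the Carleson condition. -/
theorem exists_carlesonBox_le_of_eLpNorm_le (μ : Measure Disk) {ω : Circle → ℝ≥0}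
    (hω : AEMeasurable ω arcLength) (hA1 : IsA1 ω) {p q : ℝ} (hp : 0 < p) (hpq : p ≤ q)
    {C : ℝ≥0} (hC : ∀ f : ℂ → ℂ, MemWeightedHardy p ω f →
      eLpNorm (fun z : Disk => f z) (ENNReal.ofReal q) μ ≤ C * weightedHardyNorm p ω f) :
    ∃ K : ℝ≥0, 0 < K ∧ ∀ I, IsArc I → μ (carlesonBox I) ≤ K * weightMass ω I ^ (q / p) := by
  have hq : 0 < q := hp.trans_le hpq
  set t := q / p with ht
  have ht0 : 0 < t := by positivity
  obtain ⟨A, hA⟩ := hA1.exists_setLIntegral_closedBall_le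
  -- The exponent `N` of the test function satisfies `N p ≥ 2`.
  obtain ⟨N, hN⟩ := exists_nat_ge (2 / p)
  rw [div_le_iff₀ hp] at hN
  set K₁ : ℝ≥0∞ := ENNReal.ofReal ((9 ^ N) ^ q) * ((C : ℝ≥0∞) ^ q * (1008 * A) ^ t) with hK₁
  have hK₁top : K₁ ≠ ∞ := by
    refine ENNReal.mul_ne_top ENNReal.ofReal_ne_top (ENNReal.mul_ne_top
      (ENNReal.rpow_ne_top_of_nonneg hq.le ENNReal.coe_ne_top)
      (ENNReal.rpow_ne_top_of_nonneg ht0.le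
        (ENNReal.mul_ne_top (by simp) ENNReal.coe_ne_top)))
  refine ⟨K₁.toNNReal + 1, by positivity, fun I hI => ?_⟩
  obtain ⟨ξ₀, hξ₀⟩ := hI.nonempty
  set d := (normArcLength I).toReal with hd
  have hmI : normArcLength I = ENNReal.ofReal d := (ENNReal.ofReal_toReal (measure_ne_top _ _)).symm
  have hd0 : 0 < d := by
    refine ENNReal.toReal_pos ?_ (measure_ne_top _ _)
    have h := hI.arcLength_pos
    rw [arcLength_apply] at h
    exact (pos_of_mul_pos_right h zero_le).ne'
  have hd1 : d ≤ 1 := ENNReal.toReal_le_of_le_ofReal zero_le_one (by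
    rw [ENNReal.ofReal_one]; exact prob_le_one)
  have hdist : ∀ ξ ∈ I, dist ξ ξ₀ ≤ 2 * π * d := by
    intro ξ hξ
    have h := ofReal_dist_le_arcLength hI hξ hξ₀
    rwa [arcLength_apply, hmI, ← ENNReal.ofReal_mul Real.two_pi_pos.le,
      ENNReal.ofReal_le_ofReal_iff (by positivity)] at h
  have hpi := Real.pi_lt_d2
  set a : ℂ := ((1 - d : ℝ) : ℂ) * ξ₀ with ha
  have hna : ‖a‖ = 1 - d := by
    rw [ha, norm_mul, Circle.norm_coe, mul_one, Complex.norm_real, Real.norm_of_nonneg (by linarith)]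
  have ha1 : ‖a‖ < 1 := by linarith
  set W := ∫⁻ ξ in I, ω ξ ∂normArcLength with hW
  -- The `L^p(ω)` norm of the test function, estimated by a Poisson integral of the weight.
  have hball : ∀ ρ, d ≤ ρ → ∫⁻ ζ in closedBall ξ₀ ρ, ω ζ ∂normArcLength ≤
      (7 * A * (ENNReal.ofReal d)⁻¹ * W) * ENNReal.ofReal ρ := by
    intro ρ hρ
    have hρ0 : 0 < ρ := hd0.trans_le hρ
    have hsub : I ⊆ closedBall ξ₀ (7 * ρ) := fun ξ hξ => (hdist ξ hξ).trans (by nlinarith)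
    have h1 := ae_restrict_of_ae_restrict_of_subset hsub (hA ξ₀ (7 * ρ) (by linarith))
    have h2 := lintegral_mono_ae h1
    have hdne : ENNReal.ofReal d ≠ 0 := by simpa using hd0
    rw [setLIntegral_const, lintegral_const_mul' _ _
      (ENNReal.mul_ne_top ENNReal.coe_ne_top ENNReal.ofReal_ne_top), hmI,
      ENNReal.ofReal_mul (by norm_num), ENNReal.ofReal_ofNat] at h2
    calc _ ≤ ∫⁻ ζ in closedBall ξ₀ (7 * ρ), ω ζ ∂normArcLength :=
          lintegral_mono_set (closedBall_subset_closedBall (by linarith))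
      _ = (∫⁻ ζ in closedBall ξ₀ (7 * ρ), ω ζ ∂normArcLength) * ENNReal.ofReal d *
            (ENNReal.ofReal d)⁻¹ := by
          rw [mul_assoc, ENNReal.mul_inv_cancel hdne ENNReal.ofReal_ne_top, mul_one]
      _ ≤ A * (7 * ENNReal.ofReal ρ) * W * (ENNReal.ofReal d)⁻¹ := by gcongr
      _ = _ := by ring
  set Y := ∫⁻ ξ : Circle, ‖testFun a N ξ‖ₑ ^ p * ω ξ ∂normArcLength with hY
  have hYle : Y ≤ 1008 * A * ENNReal.ofReal (d ^ (-(N * p))) * W := by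
    calc Y ≤ ∫⁻ ξ : Circle, ENNReal.ofReal (d ^ (1 - N * p)) *
          (ENNReal.ofReal (poisson a ξ) * ω ξ) ∂normArcLength := by
          refine lintegral_mono fun ξ => ?_
          rw [enorm_rpow_eq_ofReal _ hp.le, ← mul_assoc, ← ENNReal.ofReal_mul (by positivity)]
          gcongr
          have := norm_testFun_rpow_le ha1 hN ξ
          rwa [hna, sub_sub_cancel] at this
      _ = ENNReal.ofReal (d ^ (1 - N * p)) *
          ∫⁻ ξ : Circle, ENNReal.ofReal (poisson a ξ) * ω ξ ∂normArcLength :=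
          lintegral_const_mul' _ _ ENNReal.ofReal_ne_top
      _ ≤ ENNReal.ofReal (d ^ (1 - N * p)) * (144 * (7 * A * (ENNReal.ofReal d)⁻¹ * W)) := by
          gcongr
          refine lintegral_poisson_mul_le ha1 (ξ := ξ₀) (dist_le_three_mul ?_)
            (hω.mono_ac normArcLength_absolutelyContinuous).coe_nnreal_ennreal
            fun ρ hρ _ => hball ρ (by rw [hna] at hρ; linarith)
          rw [ha, norm_sub_ofReal_mul (by linarith), ← ha, hna]
          linarith
      _ = 1008 * A * (ENNReal.ofReal (d ^ (1 - N * p)) * (ENNReal.ofReal d)⁻¹) * W := by ring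
      _ = _ := by
          rw [← ENNReal.ofReal_inv_of_pos hd0, ← ENNReal.ofReal_mul (by positivity),
            ← Real.rpow_neg_one d, ← Real.rpow_add hd0]
          congr 4
          ring
  have hWtop : W < ∞ := (lintegral_mono' Measure.restrict_le_self le_rfl).trans_lt
    hA1.lintegral_lt_top
  have hYtop : Y < ∞ := hYle.trans_lt (ENNReal.mul_lt_top (ENNReal.mul_lt_top
    (ENNReal.mul_lt_top (by simp) ENNReal.coe_lt_top) ENNReal.ofReal_lt_top) hWtop)
  have hH1 := memH1_testFun ha1 N
  have hnorm : weightedHardyNorm p ω (testFun a N) = Y ^ (1 / p) := by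
    rw [weightedHardyNorm_eq hω hH1.aemeasurable_boundaryValue hp, boundaryValue_testFun ha1 N]
  have hmem : MemWeightedHardy p ω (testFun a N) := by
    refine ⟨hH1, ?_, ?_⟩
    · rw [boundaryValue_testFun ha1 N]
      exact (continuous_testFun_circle ha1 N).aestronglyMeasurable
    · exact (hnorm.trans_lt (ENNReal.rpow_lt_top_of_nonneg (by positivity) hYtop.ne))
  have hCf := hC _ hmem
  rw [hnorm, eLpNorm_ofReal_eq _ _ hq, one_div, ENNReal.rpow_inv_le_iff hq] at hCf
  -- The test function is large on the Carleson square.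
  have hbox : carlesonBox I ⊆ {z : Disk | ENNReal.ofReal ((((9 * d) ^ N)⁻¹) ^ q) ≤
      ‖testFun a N z‖ₑ ^ q} := by
    rintro z ⟨hz1, ξ, hξ, hzξ⟩
    have hzn := Disk.norm_lt_one z
    rw [← hd] at hz1
    rw [mem_ofPred_eq, enorm_rpow_eq_ofReal _ hq.le]
    refine ENNReal.ofReal_le_ofReal (Real.rpow_le_rpow (by positivity) ?_ hq.le)
    rw [testFun, norm_inv, norm_pow]
    have hpos : 0 < ‖1 - (starRingEnd ℂ) a * z‖ :=
      lt_of_lt_of_le (by linarith) (one_sub_norm_le_norm_one_sub a hzn.le)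
    refine inv_anti₀ (by positivity) (pow_le_pow_left₀ hpos.le ?_ N)
    set r := ‖(z : ℂ)‖ with hr
    have hr0 : 0 ≤ r := norm_nonneg _
    -- `1 - ā z = (1 - c) + c (1 - ξ̄₀ ξ)` with `c = (1 - d) |z|`.
    have hdec : 1 - (starRingEnd ℂ) a * z = ((1 - (1 - d) * r : ℝ) : ℂ) +
        (((1 - d) * r : ℝ) : ℂ) * (1 - (starRingEnd ℂ) (ξ₀ : ℂ) * ξ) := by
      rw [hzξ, ha, map_mul, Complex.conj_ofReal]
      push_cast
      ring
    have hc0 : 0 ≤ (1 - d) * r := mul_nonneg (by linarith) hr0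
    have hc1 : (1 - d) * r ≤ 1 := by nlinarith
    calc _ ≤ (1 - (1 - d) * r) + (1 - d) * r * ‖(ξ : ℂ) - ξ₀‖ := by
          rw [hdec]
          refine (norm_add_le _ _).trans ?_
          rw [norm_mul, Complex.norm_real, Complex.norm_real, Real.norm_of_nonneg hc0,
            Real.norm_of_nonneg (by linarith), norm_one_sub_conj_mul_circle]
      _ ≤ (1 - (1 - d) * r) + 1 * (2 * π * d) := by
          gcongr
          rw [← circle_dist_eq]
          exact hdist ξ hξ
      _ ≤ 9 * d := by nlinarith
  have hfm : Measurable fun z : Disk => ‖testFun a N z‖ₑ ^ q :=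
    (continuousOn_iff_continuous_domRestrict.1 hH1.1.continuousOn).enorm.measurable.pow_const q
  have hmarkov := (mul_le_mul_right (measure_mono hbox) _).trans
    ((mul_meas_ge_le_lintegral hfm (μ := μ) (ENNReal.ofReal ((((9 * d) ^ N)⁻¹) ^ q))).trans hCf)
  have hε : ((((9 * d) ^ N)⁻¹) ^ q) * ((9 ^ N) ^ q) = d ^ (-(N * q)) := by
    rw [← Real.mul_rpow (by positivity) (by positivity), mul_pow, mul_inv, mul_comm (9 ^ N)⁻¹,
      inv_mul_cancel_right₀ (by positivity), Real.inv_rpow (by positivity), ← Real.rpow_natCast,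
      ← Real.rpow_mul hd0.le, Real.rpow_neg hd0.le]
  have hD0 : ENNReal.ofReal (d ^ (-(N * q))) ≠ 0 := by
    simpa using Real.rpow_pos_of_pos hd0 _
  have hfinal : ENNReal.ofReal (d ^ (-(N * q))) * μ (carlesonBox I) ≤
      ENNReal.ofReal (d ^ (-(N * q))) * (K₁ * W ^ t) := by
    calc _ = ENNReal.ofReal ((9 ^ N) ^ q) *
          (ENNReal.ofReal ((((9 * d) ^ N)⁻¹) ^ q) * μ (carlesonBox I)) := by
          rw [← hε, ENNReal.ofReal_mul (by positivity)]; ring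
      _ ≤ ENNReal.ofReal ((9 ^ N) ^ q) * (C * Y ^ (1 / p)) ^ q := by gcongr
      _ = ENNReal.ofReal ((9 ^ N) ^ q) * ((C : ℝ≥0∞) ^ q * Y ^ t) := by
          rw [ENNReal.mul_rpow_of_nonneg _ _ hq.le, ← ENNReal.rpow_mul, one_div_mul_eq_div]
      _ ≤ ENNReal.ofReal ((9 ^ N) ^ q) * ((C : ℝ≥0∞) ^ q *
            (1008 * A * ENNReal.ofReal (d ^ (-(N * p))) * W) ^ t) := by gcongr
      _ = _ := by
          rw [ENNReal.mul_rpow_of_nonneg _ _ ht0.le, ENNReal.mul_rpow_of_nonneg _ _ ht0.le,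
            ENNReal.ofReal_rpow_of_nonneg (by positivity) ht0.le, ← Real.rpow_mul hd0.le,
            show -(N * p) * t = -(N * q) by rw [ht]; field_simp, hK₁]
          ring
  rw [ENNReal.mul_le_mul_iff_right hD0 ENNReal.ofReal_ne_top] at hfinal
  refine hfinal.trans ?_
  gcongr
  · rw [ENNReal.coe_add, ENNReal.coe_toNNReal hK₁top]
    exact le_self_add
  · rw [weightMass_eq]
    refine le_mul_of_one_le_left zero_le ?_
    rw [ENNReal.one_le_ofReal]
    linarith [Real.pi_gt_three]

end WeightedHardy

theorem theorem1p1 (μ : Measure WeightedHardy.Disk) (ω : Circle → ℝ≥0)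
    (hω : AEMeasurable ω WeightedHardy.arcLength) (hA1 : WeightedHardy.IsA1 ω)
    (p q : ℝ) (hp : 0 < p) (hpq : p ≤ q) :
    (∃ C : ℝ≥0, 0 < C ∧ ∀ f : ℂ → ℂ, WeightedHardy.MemWeightedHardy p ω f →
        eLpNorm (fun z : WeightedHardy.Disk => f z) (ENNReal.ofReal q) μ ≤
          C * WeightedHardy.weightedHardyNorm p ω f) ↔
      (∃ C : ℝ≥0, 0 < C ∧ ∀ I : Set Circle, WeightedHardy.IsArc I →
        μ (WeightedHardy.carlesonBox I) ≤ C * (WeightedHardy.weightMass ω I) ^ (q / p)) :=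
  ⟨fun ⟨_, _, hC⟩ => WeightedHardy.exists_carlesonBox_le_of_eLpNorm_le μ hω hA1 hp hpq hC,
    fun ⟨_, _, hK⟩ => WeightedHardy.exists_eLpNorm_le_of_carlesonBox_le μ hω hA1 hp hpq hK⟩
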